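/- Conventions. Manifolds are topological, Hausdorff and second countable, not necessarily connected. For $n\in\mathbb N$ let $\Delta^n$ be the standard $n$-simplex and $\square^n=[0,1]^n$. For a space $X$, let $C_*(X;\mathbb R)$ be the singular chain complex with the $\ell^1$-norm with respect to the basis of singular simplices. Let $Q_n(X;\mathbb R)$ be the free $\mathbb R$-module on the continuous maps $c\colon\square^n\to X$, with the $\ell^1$-norm and the boundary $\partial c=\sum_{j=1}^n(-1)^j\,(c|_{x_j=0}-c|_{x_j=1})$, let $D_n(X;\mathbb R)$ be generated by the degenerate cubes (those independent of one of the coordinates), and let $C^\square_*(X;\mathbb R)=Q_*(X;\mathbb R)/D_*(X;\mathbb R)$ with the quotient norm. Let $F$ denote $C_*$ or $C_*^\square$. For $A\subset X$ put $F(X,A)=F(X)/F(A)$ with the quotient semi-norm, and put $F^{\mathrm{lf}}(X)=\varprojlim_K F(X,X\setminus K)$, where $K$ runs through the compact subsets of $X$. The semi-norm of $(c_K)_K\in F^{\mathrm{lf}}_n(X)$ is the infimum (in $[0,\infty]$) of $\lim_K\|\bar c_K\|$ over all Cauchy families $(\bar c_K)_K$ in $F_n(X)$ such that $\bar c_K$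 represents $c_K$ for all $K$ (for $F=C_*$ this is the $\ell^1$-norm on locally finite singular chains). The semi-norm of a homology class is the infimum of the semi-norms of the cycles representing it. The canonical natural isomorphism from singular homology to cubical singular homology (also in the relative and the locally finite case) is induced by the chain map $\sigma\mapsto\sigma\circ\kappa_n$, where $\kappa_n\colon\square^n\to\Delta^n$, $(x_1,\dots,x_n)\mapsto(1-x_1,\;x_1(1-x_2),\;\dots,\;x_1\cdots x_{n-1}(1-x_n),\;x_1\cdots x_n)$. For an oriented compact $n$-manifold $M$ with (possibly empty) boundary $\partial M$, let $[M,\partial M]\in H_n(M,\partial M;\mathbb R)$ be the fundamental class, i.e., the class that restricts to the given local orientation in $H_n(M,M\setminus\{x\};\mathbb R)$ for all interior points $x$. Let $\|M,\partial M\|$ be its semi-norm, and let $\|M,\partial M\|^\square$ be the semi-norm of the corresponding class in $H_n^\square(M,\partial M;\mathbb R)$. For an oriented $n$-manifold $M$ without boundary, define $\|M\|^{\mathrm{lf}},\ \|M\|^{\square,\mathrm{lf}}\in[0,\infty]$ in the same way through the locally finite fundamental class in $H_n^{\mathrm{lf}}(M;\mathbb R)$. Statement. Let $n\in\mathbb N$.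 (1) For all oriented compact $n$-manifolds $M$, $$\frac1{2^n\cdot n!}\cdot\|M,\partial M\|\;\le\;\|M,\partial M\|^\square\;\le\;\|M,\partial M\|.$$ (2) For all oriented $n$-manifolds $M$ without boundary, $$\frac1{2^n\cdot n!}\cdot\|M\|^{\mathrm{lf}}\;\le\;\|M\|^{\square,\mathrm{lf}}\;\le\;\|M\|^{\mathrm{lf}}.$$ -/

import Mathlib

open CategoryTheory Filter Topology
open scoped ENNReal

universe u

noncomputable section

namespace CubicalVolume

/-! ### A vanishing lemma for alternating sums of face maps -/

theorem alternating_sum_comp_eq_zero {m : ℕ} {A B C : Type*} [AddCommGroup A] [AddCommGroup B]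
    [AddCommGroup C] (f : Fin (m + 2) → A →+ B) (g : Fin (m + 1) → B →+ C)
    (h : ∀ i j : Fin (m + 1), i ≤ j → ∀ a, g i (f j.succ a) = g j (f i.castSucc a)) (a : A) :
    (∑ i : Fin (m + 1), (-1 : ℤ) ^ (i : ℕ) • g i) ((∑ j : Fin (m + 2), (-1 : ℤ) ^ (j : ℕ) • f j) a)
      = 0 := by
  simp only [AddMonoidHom.finsetSum_apply, map_sum, AddMonoidHom.smul_apply, map_zsmul,
    Finset.smul_sum]
  rw [Finset.sum_comm, ← Finset.sum_product']
  let P := Fin (m + 1) × Fin (m + 2)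
  let S : Finset P := {ij : P | (ij.2 : ℕ) ≤ (ij.1 : ℕ)}
  rw [Finset.univ_product_univ, ← Finset.sum_add_sum_compl S, ← eq_neg_iff_add_eq_zero,
    ← Finset.sum_neg_distrib]
  let φ : ∀ ij : P, ij ∈ S → P := fun ij hij =>
    (Fin.castLT ij.2 (lt_of_le_of_lt (Finset.mem_filter.mp hij).right (Fin.is_lt ij.1)), ij.1.succ)
  apply Finset.sum_bij φ
  · intro ij hij
    simp_rw [S, φ, Finset.compl_filter, Finset.mem_filter_univ, Fin.val_succ,
      Fin.val_castLT] at hij ⊢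
    lia
  · rintro ⟨i, j⟩ hij ⟨i', j'⟩ hij' h
    rw [Prod.mk_inj]
    exact ⟨by simpa [φ] using! congr_arg Prod.snd h,
      by simpa [φ, Fin.castSucc_castLT] using! congr_arg Fin.castSucc (congr_arg Prod.fst h)⟩
  · rintro ⟨i', j'⟩ hij'
    simp_rw [S, Finset.compl_filter, Finset.mem_filter_univ, not_le] at hij'
    refine ⟨(j'.pred <| ?_, Fin.castSucc i'), ?_, ?_⟩
    · rintro rfl
      simp at hij'
    · simp only [S, Finset.mem_filter_univ, Fin.val_castSucc, Fin.val_pred]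
      lia
    · simp [φ]
  · rintro ⟨i, j⟩ hij
    simp only [S, Finset.mem_filter_univ] at hij
    have hj : (j : ℕ) < m + 1 := lt_of_le_of_lt hij i.2
    have := h (j.castLT hj) i (by simpa [Fin.le_def] using hij) a
    simp only [φ, Fin.val_castLT, Fin.val_succ, Fin.castSucc_castLT] at this ⊢
    rw [this, smul_smul, smul_smul, ← neg_smul]
    congr 1
    ring

/-! ### Singular chains -/

/-- The standard `n`-simplex. -/
abbrev Simplex (n : ℕ) : Type := stdSimplex ℝ (Fin (n + 1))

/-- The inclusion of the `i`-th face of the standard `(n + 1)`-simplex. -/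
def simplexFace {n : ℕ} (i : Fin (n + 2)) : C(Simplex n, Simplex (n + 1)) :=
  ⟨stdSimplex.map i.succAbove, stdSimplex.continuous_map _⟩

theorem simplexFace_comp {n : ℕ} (i j : Fin (n + 2)) (h : i ≤ j) :
    (simplexFace j.succ).comp (simplexFace i) =
      (simplexFace i.castSucc).comp (simplexFace j) := by
  ext1 x
  simp only [simplexFace, ContinuousMap.comp_apply, ContinuousMap.coe_mk,
    stdSimplex.map_comp_apply]
  congr 1
  funext k
  simp only [Function.comp, Fin.succAbove, Fin.ext_iff, Fin.lt_def, Fin.le_def] at *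
  grind

/-- The singular `n`-chains of `X` with coefficients in `R`. -/
abbrev SingChain (R : Type) [Ring R] (n : ℕ) (X : Type u) [TopologicalSpace X] : Type u :=
  C(Simplex n, X) →₀ R

/-- The singular boundary, `∂σ = ∑ i, (-1)^i • (σ ∘ i-th face)`. -/
def singBoundary (R : Type) [Ring R] (n : ℕ) (X : Type u) [TopologicalSpace X] :
    SingChain R (n + 1) X →+ SingChain R n X :=
  ∑ i : Fin (n + 2), (-1 : ℤ) ^ (i : ℕ) •
    Finsupp.mapDomain.addMonoidHom (fun σ : C(Simplex (n + 1), X) => σ.comp (simplexFace i))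

theorem singBoundary_singBoundary (R : Type) [Ring R] (n : ℕ) (X : Type u) [TopologicalSpace X]
    (c : SingChain R (n + 2) X) : singBoundary R n X (singBoundary R (n + 1) X c) = 0 := by
  refine alternating_sum_comp_eq_zero _ _ (fun i j hij c => ?_) c
  simp only [Finsupp.mapDomain.addMonoidHom_apply, ← Finsupp.mapDomain_comp]
  congr 1
  funext σ
  simp only [Function.comp, ContinuousMap.comp_assoc, simplexFace_comp i j hij]

/-- The singular chain complex of `X` with coefficients in `R`. -/
def singComplex (R : Type) [Ring R] (X : TopCat.{u}) : ChainComplex AddCommGrpCat.{u} ℕ :=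
  ChainComplex.of (fun n => AddCommGrpCat.of (SingChain R n X))
    (fun n => AddCommGrpCat.ofHom (singBoundary R n X))
    (fun n => AddCommGrpCat.hom_ext (AddMonoidHom.ext (singBoundary_singBoundary R n X)))

/-- The map on singular chains induced by a continuous map. -/
def singMap (R : Type) [Ring R] (n : ℕ) {X Y : Type u} [TopologicalSpace X] [TopologicalSpace Y]
    (f : C(X, Y)) : SingChain R n X →+ SingChain R n Y :=
  Finsupp.mapDomain.addMonoidHom (fun σ => f.comp σ)

/-- The singular chain complex with coefficients in `R`, as a functor on topological spaces. -/
def singular (R : Type) [Ring R] : TopCat.{u} ⥤ ChainComplex AddCommGrpCat.{u} ℕ where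
  obj X := singComplex R X
  map {X Y} f := ChainComplex.ofHom (X := singComplex R X) (Y := singComplex R Y)
    (fun n => AddCommGrpCat.ofHom (singMap R n f.hom))
    (fun n => by
      simp only [singComplex, ChainComplex.of_d]
      refine AddCommGrpCat.hom_ext (AddMonoidHom.ext fun c => ?_)
      change singBoundary R n Y (singMap R (n + 1) f.hom c) =
        singMap R n f.hom (singBoundary R n X c)
      simp only [singBoundary, singMap, AddMonoidHom.finsetSum_apply, AddMonoidHom.smul_apply,
        map_sum, map_zsmul, Finsupp.mapDomain.addMonoidHom_apply, ← Finsupp.mapDomain_comp]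
      rfl)
  map_id X := by
    ext n : 1
    refine AddCommGrpCat.hom_ext (AddMonoidHom.ext fun c => ?_)
    exact Finsupp.mapDomain_id
  map_comp f g := by
    ext n : 1
    refine AddCommGrpCat.hom_ext (AddMonoidHom.ext fun c => ?_)
    exact Finsupp.mapDomain_comp (f := fun σ => f.hom.comp σ) (g := fun σ => g.hom.comp σ)

/-- The `ℓ¹`-norm with respect to the basis of singular simplices. -/
def singNorm (X : TopCat.{u}) (n : ℕ) (c : ((singular ℝ).obj X).X n) : ℝ≥0∞ :=
  Finsupp.sum (show SingChain ℝ n X from c) fun _ a => ‖a‖ₑ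

/-- The change of coefficients from `ℤ` to `ℝ`. -/
def intToReal : singular.{u} ℤ ⟶ singular.{u} ℝ where
  app X := ChainComplex.ofHom (X := singComplex ℤ X) (Y := singComplex ℝ X)
    (fun n => AddCommGrpCat.ofHom (Finsupp.mapRange.addMonoidHom (Int.castAddHom ℝ)))
    (fun n => by
      simp only [singComplex, ChainComplex.of_d]
      refine AddCommGrpCat.hom_ext (AddMonoidHom.ext fun c => ?_)
      change singBoundary ℝ n X (Finsupp.mapRange.addMonoidHom (Int.castAddHom ℝ) c) =
        Finsupp.mapRange.addMonoidHom (Int.castAddHom ℝ) (singBoundary ℤ n X c)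
      simp only [singBoundary, AddMonoidHom.finsetSum_apply, AddMonoidHom.smul_apply,
        map_sum, map_zsmul, Finsupp.mapDomain.addMonoidHom_apply,
        Finsupp.mapRange.addMonoidHom_apply]
      refine Finset.sum_congr rfl fun i _ => ?_
      congr 1
      exact Finsupp.mapDomain_mapRange _ _ _ (map_zero _) (map_add _))
  naturality X Y f := by
    ext n : 1
    refine AddCommGrpCat.hom_ext (AddMonoidHom.ext fun c => ?_)
    exact (Finsupp.mapDomain_mapRange (fun σ => f.hom.comp σ) c (Int.castAddHom ℝ)
      (map_zero _) (map_add _)).symm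

/-! ### Cubical singular chains -/

/-- The standard `n`-cube `[0,1]^n`. -/
abbrev Cube (n : ℕ) : Type := Fin n → unitInterval

/-- The inclusion of the face of the `(n + 1)`-cube on which the `j`-th coordinate is `e`
(used for `e = 0` and `e = 1`). -/
def cubeFace {n : ℕ} (j : Fin (n + 1)) (e : unitInterval) : C(Cube n, Cube (n + 1)) :=
  ⟨fun x => Fin.insertNth (α := fun _ => unitInterval) j e x, by fun_prop⟩

theorem cubeFace_same {n : ℕ} (j : Fin (n + 1)) (e : unitInterval) (x : Cube n) :
    cubeFace j e x j = e := Fin.insertNth_apply_same (α := fun _ => unitInterval) j e x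

theorem cubeFace_succAbove {n : ℕ} (j : Fin (n + 1)) (e : unitInterval) (x : Cube n) (k : Fin n) :
    cubeFace j e x (j.succAbove k) = x k :=
  Fin.insertNth_apply_succAbove (α := fun _ => unitInterval) j e x k

theorem cubeFace_comp {n : ℕ} (i j : Fin (n + 1)) (h : i ≤ j) (a b : unitInterval) :
    (cubeFace j.succ b).comp (cubeFace i a) = (cubeFace i.castSucc a).comp (cubeFace j b) := by
  have h1 : j.succ.succAbove i = i.castSucc := by
    simp only [Fin.succAbove, Fin.ext_iff, Fin.lt_def, Fin.le_def] at *
    grind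
  have h2 : i.castSucc.succAbove j = j.succ := by
    simp only [Fin.succAbove, Fin.ext_iff, Fin.lt_def, Fin.le_def] at *
    grind
  have h3 : ∀ k : Fin n, i.castSucc.succAbove (j.succAbove k) =
      j.succ.succAbove (i.succAbove k) := by
    intro k
    simp only [Fin.succAbove, Fin.ext_iff, Fin.lt_def, Fin.le_def] at *
    grind
  ext1 x
  simp only [ContinuousMap.comp_apply]
  funext k
  obtain rfl | ⟨k, rfl⟩ := Fin.eq_self_or_eq_succAbove i.castSucc k
  · rw [cubeFace_same, ← h1, cubeFace_succAbove, cubeFace_same]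
  · rw [cubeFace_succAbove]
    obtain rfl | ⟨k, rfl⟩ := Fin.eq_self_or_eq_succAbove j k
    · rw [h2, cubeFace_same, cubeFace_same]
    · rw [h3, cubeFace_succAbove, cubeFace_succAbove, cubeFace_succAbove]

/-- A singular cube is degenerate if it is independent of one of the coordinates. -/
def IsDegenerate {n : ℕ} {X : Type u} [TopologicalSpace X] (c : C(Cube n, X)) : Prop :=
  ∃ j : Fin n, ∀ (x : Cube n) (t : unitInterval), c (Function.update x j t) = c x

/-- The free module `Q_n(X; ℝ)` on all singular `n`-cubes of `X`. -/
abbrev CubeChain (n : ℕ) (X : Type u) [TopologicalSpace X] : Type u :=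
  C(Cube n, X) →₀ ℝ

/-- The difference `c ↦ c ∘ (j,1)-face - c ∘ (j,0)-face` of opposite faces. -/
def oppositeFaces (n : ℕ) (X : Type u) [TopologicalSpace X] (j : Fin (n + 1)) :
    CubeChain (n + 1) X →+ CubeChain n X :=
  Finsupp.mapDomain.addMonoidHom (fun c : C(Cube (n + 1), X) => c.comp (cubeFace j 1)) -
    Finsupp.mapDomain.addMonoidHom (fun c : C(Cube (n + 1), X) => c.comp (cubeFace j 0))

/-- The cubical boundary. The coordinates are numbered from `0` here, whence the sign:
`∂c = ∑ j, (-1)^(j+1) • (c ∘ (j,0)-face - c ∘ (j,1)-face)`. -/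
def cubeBoundary (n : ℕ) (X : Type u) [TopologicalSpace X] :
    CubeChain (n + 1) X →+ CubeChain n X :=
  ∑ j : Fin (n + 1), (-1 : ℤ) ^ (j : ℕ) • oppositeFaces n X j

theorem cubeBoundary_cubeBoundary (n : ℕ) (X : Type u) [TopologicalSpace X]
    (c : CubeChain (n + 2) X) : cubeBoundary n X (cubeBoundary (n + 1) X c) = 0 := by
  refine alternating_sum_comp_eq_zero _ _ (fun i j hij c => ?_) c
  have key : ∀ a b : unitInterval,
      (fun c : C(Cube (n + 1), X) => c.comp (cubeFace i a)) ∘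
        (fun c : C(Cube (n + 2), X) => c.comp (cubeFace j.succ b)) =
      (fun c : C(Cube (n + 1), X) => c.comp (cubeFace j b)) ∘
        (fun c : C(Cube (n + 2), X) => c.comp (cubeFace i.castSucc a)) := by
    intro a b
    funext σ
    simp only [Function.comp, ContinuousMap.comp_assoc, cubeFace_comp i j hij]
  simp only [oppositeFaces, AddMonoidHom.sub_apply, map_sub,
    Finsupp.mapDomain.addMonoidHom_apply, ← Finsupp.mapDomain_comp, key]
  abel

/-- The subgroup `D_n(X; ℝ)` of `Q_n(X; ℝ)` generated by the multiples of degenerate cubes. -/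
def degenerateChains (n : ℕ) (X : Type u) [TopologicalSpace X] : AddSubgroup (CubeChain n X) :=
  AddSubgroup.closure {q | ∃ (c : C(Cube n, X)) (a : ℝ), IsDegenerate c ∧ q = Finsupp.single c a}

theorem single_mem_degenerateChains {n : ℕ} {X : Type u} [TopologicalSpace X] {c : C(Cube n, X)}
    (h : IsDegenerate c) (a : ℝ) : Finsupp.single c a ∈ degenerateChains n X :=
  AddSubgroup.subset_closure ⟨c, a, h, rfl⟩

theorem degenerateChains_le_comap_boundary (n : ℕ) (X : Type u) [TopologicalSpace X] :
    degenerateChains (n + 1) X ≤ (degenerateChains n X).comap (cubeBoundary n X) := by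
  refine (AddSubgroup.closure_le _).2 ?_
  rintro _ ⟨c, a, ⟨j, hj⟩, rfl⟩
  change cubeBoundary n X _ ∈ degenerateChains n X
  simp only [cubeBoundary, AddMonoidHom.finsetSum_apply, AddMonoidHom.smul_apply]
  refine AddSubgroup.sum_mem _ fun k _ => AddSubgroup.zsmul_mem _ ?_ _
  simp only [oppositeFaces, AddMonoidHom.sub_apply, Finsupp.mapDomain.addMonoidHom_apply,
    Finsupp.mapDomain_single]
  obtain rfl | ⟨i, rfl⟩ := Fin.eq_self_or_eq_succAbove k j
  · have : c.comp (cubeFace j 1) = c.comp (cubeFace j 0) := by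
      ext1 x
      simp only [ContinuousMap.comp_apply]
      rw [← hj (cubeFace j 1 x) 0]
      congr 1
      funext l
      obtain rfl | ⟨l, rfl⟩ := Fin.eq_self_or_eq_succAbove j l
      · simp [cubeFace_same]
      · rw [Function.update_of_ne (Fin.succAbove_ne _ _), cubeFace_succAbove, cubeFace_succAbove]
    rw [this, sub_self]
    exact AddSubgroup.zero_mem _
  · have : ∀ e, IsDegenerate (c.comp (cubeFace k e)) := by
      refine fun e => ⟨i, fun x t => ?_⟩
      simp only [ContinuousMap.comp_apply]
      rw [← hj (cubeFace k e x) t]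
      congr 1
      funext l
      obtain rfl | ⟨l, rfl⟩ := Fin.eq_self_or_eq_succAbove k l
      · rw [Function.update_of_ne (Fin.succAbove_ne _ _).symm, cubeFace_same, cubeFace_same]
      · rw [cubeFace_succAbove]
        by_cases h : l = i
        · subst h; simp
        · rw [Function.update_of_ne h, Function.update_of_ne (by simpa using h),
            cubeFace_succAbove]
    exact AddSubgroup.sub_mem _ (single_mem_degenerateChains (this 1) a)
      (single_mem_degenerateChains (this 0) a)

/-- The cubical chain module `C_n^□(X; ℝ) = Q_n(X; ℝ) / D_n(X; ℝ)`. -/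
abbrev CubicalChain (n : ℕ) (X : Type u) [TopologicalSpace X] : Type u :=
  CubeChain n X ⧸ degenerateChains n X

/-- The boundary on `C_*^□(X; ℝ)`. -/
def cubicalBoundary (n : ℕ) (X : Type u) [TopologicalSpace X] :
    CubicalChain (n + 1) X →+ CubicalChain n X :=
  QuotientAddGroup.map _ _ (cubeBoundary n X) (degenerateChains_le_comap_boundary n X)

/-- The cubical chain complex of `X`. -/
def cubicalComplex (X : TopCat.{u}) : ChainComplex AddCommGrpCat.{u} ℕ :=
  ChainComplex.of (fun n => AddCommGrpCat.of (CubicalChain n X))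
    (fun n => AddCommGrpCat.ofHom (cubicalBoundary n X))
    (fun n => by
      refine AddCommGrpCat.hom_ext (AddMonoidHom.ext fun c => ?_)
      obtain ⟨c, rfl⟩ := QuotientAddGroup.mk_surjective c
      exact congrArg QuotientAddGroup.mk (cubeBoundary_cubeBoundary n X c))

/-- The map on `Q_n` induced by a continuous map. -/
def cubeMap (n : ℕ) {X Y : Type u} [TopologicalSpace X] [TopologicalSpace Y]
    (f : C(X, Y)) : CubeChain n X →+ CubeChain n Y :=
  Finsupp.mapDomain.addMonoidHom (fun c => f.comp c)

theorem degenerateChains_le_comap_map (n : ℕ) {X Y : Type u} [TopologicalSpace X]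
    [TopologicalSpace Y] (f : C(X, Y)) :
    degenerateChains n X ≤ (degenerateChains n Y).comap (cubeMap n f) := by
  refine (AddSubgroup.closure_le _).2 ?_
  rintro _ ⟨c, a, ⟨j, hj⟩, rfl⟩
  change cubeMap n f _ ∈ degenerateChains n Y
  simp only [cubeMap, Finsupp.mapDomain.addMonoidHom_apply, Finsupp.mapDomain_single]
  exact single_mem_degenerateChains ⟨j, fun x t => congrArg f (hj x t)⟩ a

/-- The map on cubical chains induced by a continuous map. -/
def cubicalMap (n : ℕ) {X Y : Type u} [TopologicalSpace X] [TopologicalSpace Y]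
    (f : C(X, Y)) : CubicalChain n X →+ CubicalChain n Y :=
  QuotientAddGroup.map _ _ (cubeMap n f) (degenerateChains_le_comap_map n f)

/-- The cubical chain complex `C_*^□(·; ℝ)` as a functor on topological spaces. -/
def cubical : TopCat.{u} ⥤ ChainComplex AddCommGrpCat.{u} ℕ where
  obj X := cubicalComplex X
  map {X Y} f := ChainComplex.ofHom (X := cubicalComplex X) (Y := cubicalComplex Y)
    (fun n => AddCommGrpCat.ofHom (cubicalMap n f.hom))
    (fun n => by
      simp only [cubicalComplex, ChainComplex.of_d]
      refine AddCommGrpCat.hom_ext (AddMonoidHom.ext fun c => ?_)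
      obtain ⟨c, rfl⟩ := QuotientAddGroup.mk_surjective c
      refine congrArg QuotientAddGroup.mk (?_ : cubeBoundary n Y (cubeMap (n + 1) f.hom c) =
        cubeMap n f.hom (cubeBoundary n X c))
      simp only [cubeBoundary, cubeMap, oppositeFaces, AddMonoidHom.finsetSum_apply,
        AddMonoidHom.smul_apply, AddMonoidHom.sub_apply, map_sum, map_sub, map_zsmul,
        Finsupp.mapDomain.addMonoidHom_apply, ← Finsupp.mapDomain_comp]
      rfl)
  map_id X := by
    ext n : 1
    refine AddCommGrpCat.hom_ext (AddMonoidHom.ext fun c => ?_)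
    obtain ⟨c, rfl⟩ := QuotientAddGroup.mk_surjective c
    exact congrArg QuotientAddGroup.mk Finsupp.mapDomain_id
  map_comp f g := by
    ext n : 1
    refine AddCommGrpCat.hom_ext (AddMonoidHom.ext fun c => ?_)
    obtain ⟨c, rfl⟩ := QuotientAddGroup.mk_surjective c
    exact congrArg QuotientAddGroup.mk
      (Finsupp.mapDomain_comp (f := fun σ => f.hom.comp σ) (g := fun σ => g.hom.comp σ))

/-- The norm on `C_n^□(X; ℝ)` induced from the `ℓ¹`-norm on `Q_n(X; ℝ)`. -/
def cubicalNorm (X : TopCat.{u}) (n : ℕ) (c : (cubical.obj X).X n) : ℝ≥0∞ :=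
  ⨅ (q : CubeChain n X) (_ : (QuotientAddGroup.mk q : CubicalChain n X) = c),
    q.sum fun _ a => ‖a‖ₑ

/-! ### The comparison of singular and cubical homology -/

/-- The product `x_0 ⋯ x_(m-1)` of the first `m` coordinates if `m ≤ n`, and `0` if `n < m`. -/
def initialProd {n : ℕ} (x : Cube n) (m : ℕ) : ℝ :=
  if m ≤ n then ∏ k : Fin n, (if (k : ℕ) < m then (x k : ℝ) else 1) else 0

theorem initialProd_nonneg {n : ℕ} (x : Cube n) (m : ℕ) : 0 ≤ initialProd x m := by
  unfold initialProd
  split_ifs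
  · refine Finset.prod_nonneg fun k _ => ?_
    split_ifs
    · exact (x k).2.1
    · exact zero_le_one
  · exact le_rfl

theorem initialProd_succ_le {n : ℕ} (x : Cube n) (m : ℕ) :
    initialProd x (m + 1) ≤ initialProd x m := by
  by_cases h : m + 1 ≤ n
  · rw [initialProd, initialProd, if_pos h, if_pos (by lia)]
    refine Finset.prod_le_prod (fun k _ => ?_) fun k _ => ?_
    · split_ifs
      · exact (x k).2.1
      · exact zero_le_one
    · by_cases h1 : (k : ℕ) < m
      · rw [if_pos h1, if_pos (by lia)]
      · rw [if_neg h1]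
        split_ifs
        · exact (x k).2.2
        · exact le_rfl
  · rw [initialProd, if_neg h]
    exact initialProd_nonneg x m

theorem continuous_initialProd {n : ℕ} (m : ℕ) :
    Continuous fun x : Cube n => initialProd x m := by
  unfold initialProd
  split_ifs
  · refine continuous_finsetProd _ fun k _ => ?_
    split_ifs <;> fun_prop
  · exact continuous_const

theorem initialProd_cubeFace {n : ℕ} (j : Fin (n + 1)) (e : unitInterval) (x : Cube n) (m : ℕ)
    (hm : m ≤ n + 1) : initialProd (cubeFace j e x) m =
      if (j : ℕ) < m then e * initialProd x (m - 1) else initialProd x m := by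
  rw [initialProd, if_pos hm, Fin.prod_univ_succAbove _ j, cubeFace_same]
  simp only [cubeFace_succAbove]
  by_cases h : (j : ℕ) < m
  · rw [if_pos h, if_pos h, initialProd, if_pos (by lia)]
    congr 1
    refine Finset.prod_congr rfl fun k _ => ?_
    have : ((j.succAbove k : Fin (n + 1)) : ℕ) < m ↔ (k : ℕ) < m - 1 := by
      simp only [Fin.succAbove, Fin.lt_def]
      grind
    simp only [this]
  · rw [if_neg h, if_neg h, initialProd, if_pos (by lia), one_mul]
    refine Finset.prod_congr rfl fun k _ => ?_
    have : ((j.succAbove k : Fin (n + 1)) : ℕ) < m ↔ (k : ℕ) < m := by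
      simp only [Fin.succAbove, Fin.lt_def]
      grind
    simp only [this]

/-- The collapse of the `n`-cube onto the `n`-simplex,
`(x_0, …, x_(n-1)) ↦ (1 - x_0, x_0 (1 - x_1), …, x_0 ⋯ x_(n-2) (1 - x_(n-1)), x_0 ⋯ x_(n-1))`. -/
def collapse (n : ℕ) : C(Cube n, Simplex n) where
  toFun x := ⟨fun i => initialProd x i - initialProd x (i + 1),
    fun i => sub_nonneg.2 (initialProd_succ_le x i), by
      rw [Fin.sum_univ_eq_sum_range (fun i => initialProd x i - initialProd x (i + 1)) (n + 1),
        Finset.sum_range_sub']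
      simp [initialProd]⟩
  continuous_toFun := by
    refine Continuous.subtype_mk (continuous_pi fun i => ?_) _
    exact (continuous_initialProd _).sub (continuous_initialProd _)

theorem collapse_apply (n : ℕ) (x : Cube n) (i : Fin (n + 1)) :
    collapse n x i = initialProd x i - initialProd x (i + 1) := rfl

theorem simplexFace_same {n : ℕ} (i : Fin (n + 2)) (t : Simplex n) : simplexFace i t i = 0 := by
  change stdSimplex.map i.succAbove t i = 0
  rw [stdSimplex.map_coe, FunOnFinite.linearMap_apply_apply]
  refine Finset.sum_eq_zero fun k hk => ?_
  simp [Fin.succAbove_ne] at hk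

theorem simplexFace_succAbove {n : ℕ} (i : Fin (n + 2)) (t : Simplex n) (k : Fin (n + 1)) :
    simplexFace i t (i.succAbove k) = t k := by
  change stdSimplex.map i.succAbove t (i.succAbove k) = t k
  rw [stdSimplex.map_coe, FunOnFinite.linearMap_apply_apply]
  simp [Finset.filter_eq']

theorem collapse_comp_face_one {n : ℕ} (j : Fin (n + 1)) :
    (collapse (n + 1)).comp (cubeFace j 1) = (simplexFace j.castSucc).comp (collapse n) := by
  have key : ∀ (x : Cube n) (m : ℕ), initialProd (cubeFace j 1 x) m =
      initialProd x (if (j : ℕ) < m then m - 1 else m) := by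
    intro x m
    by_cases hm : m ≤ n + 1
    · rw [initialProd_cubeFace _ _ _ _ hm]
      split_ifs <;> simp
    · rw [if_pos (by lia), initialProd, if_neg hm, initialProd, if_neg (by lia)]
  ext x i
  simp only [ContinuousMap.comp_apply]
  rw [collapse_apply, key, key]
  obtain rfl | ⟨k, rfl⟩ := Fin.eq_self_or_eq_succAbove j.castSucc i
  · rw [simplexFace_same]
    simp
  · rw [simplexFace_succAbove, collapse_apply]
    congr 2 <;>
    · simp only [Fin.succAbove, Fin.lt_def]
      grind

theorem collapse_comp_face_zero_last (n : ℕ) :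
    (collapse (n + 1)).comp (cubeFace (Fin.last n) 0) =
      (simplexFace (Fin.last (n + 1))).comp (collapse n) := by
  have key : ∀ (x : Cube n) (m : ℕ), initialProd (cubeFace (Fin.last n) 0 x) m =
      initialProd x m := by
    intro x m
    by_cases hm : m ≤ n + 1
    · rw [initialProd_cubeFace _ _ _ _ hm]
      split_ifs with h
      · rw [Fin.val_last] at h
        rw [initialProd, initialProd, if_neg (by lia : ¬ m ≤ n)]
        simp
      · rfl
    · rw [initialProd, if_neg hm, initialProd, if_neg (by lia)]
  ext x i
  simp only [ContinuousMap.comp_apply]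
  rw [collapse_apply, key, key]
  obtain rfl | ⟨k, rfl⟩ := Fin.eq_self_or_eq_succAbove (Fin.last (n + 1)) i
  · rw [simplexFace_same]
    simp [initialProd]
  · rw [simplexFace_succAbove, collapse_apply]
    simp

theorem isDegenerate_comp_collapse {n : ℕ} {X : Type u} [TopologicalSpace X]
    (σ : C(Simplex (n + 1), X)) (j : Fin (n + 1)) (hj : j ≠ Fin.last n) :
    IsDegenerate ((σ.comp (collapse (n + 1))).comp (cubeFace j 0)) := by
  have hjn : (j : ℕ) < n := Fin.val_lt_last hj
  refine ⟨⟨j, hjn⟩, fun x t => ?_⟩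
  have key : ∀ m, initialProd (cubeFace j 0 (Function.update x ⟨j, hjn⟩ t)) m =
      initialProd (cubeFace j 0 x) m := by
    intro m
    by_cases hm : m ≤ n + 1
    · rw [initialProd_cubeFace _ _ _ _ hm, initialProd_cubeFace _ _ _ _ hm]
      split_ifs with h
      · simp
      · rw [initialProd, initialProd, if_pos (by lia), if_pos (by lia)]
        refine Finset.prod_congr rfl fun k _ => ?_
        by_cases hk : (k : ℕ) < m
        · rw [if_pos hk, if_pos hk, Function.update_of_ne]
          rintro rfl
          exact h hk
        · rw [if_neg hk, if_neg hk]
    · rw [initialProd, if_neg hm, initialProd, if_neg hm]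
  simp only [ContinuousMap.comp_apply]
  congr 1
  ext i
  rw [collapse_apply, collapse_apply, key, key]

theorem alternating_sum_sub {n : ℕ} {G : Type*} [AddCommGroup G] (a b : Fin (n + 1) → G)
    (c : Fin (n + 2) → G) (h1 : ∀ j : Fin (n + 1), a j = c j.castSucc)
    (h2 : b (Fin.last n) = c (Fin.last (n + 1))) (h3 : ∀ j : Fin n, b j.castSucc = 0) :
    ∑ j : Fin (n + 1), (-1 : ℤ) ^ (j : ℕ) • (a j - b j) =
      ∑ i : Fin (n + 2), (-1 : ℤ) ^ (i : ℕ) • c i := by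
  simp only [zsmul_sub, Finset.sum_sub_distrib]
  rw [Fin.sum_univ_castSucc (fun j : Fin (n + 1) => (-1 : ℤ) ^ (j : ℕ) • b j),
    Fin.sum_univ_castSucc (n := n + 1)]
  simp only [h1, h2, h3, zsmul_zero, Finset.sum_const_zero, zero_add, Fin.val_castSucc,
    Fin.val_last, pow_succ, mul_neg, mul_one, neg_zsmul, sub_eq_add_neg]

/-- Precomposition with the collapse, as a map from singular to cubical chains. -/
def collapseHom (n : ℕ) (X : Type u) [TopologicalSpace X] :
    SingChain ℝ n X →+ CubicalChain n X :=
  (QuotientAddGroup.mk' (degenerateChains n X)).comp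
    (Finsupp.mapDomain.addMonoidHom (fun σ : C(Simplex n, X) => σ.comp (collapse n)))

theorem collapseHom_single (n : ℕ) (X : Type u) [TopologicalSpace X] (σ : C(Simplex n, X))
    (a : ℝ) : collapseHom n X (Finsupp.single σ a) =
      QuotientAddGroup.mk (Finsupp.single (σ.comp (collapse n)) a) := by
  simp [collapseHom]

theorem cubicalBoundary_collapseHom (n : ℕ) (X : Type u) [TopologicalSpace X]
    (c : SingChain ℝ (n + 1) X) :
    cubicalBoundary n X (collapseHom (n + 1) X c) = collapseHom n X (singBoundary ℝ n X c) := by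
  induction c using Finsupp.induction_linear with
  | zero => simp
  | add f g hf hg => simp only [map_add, hf, hg]
  | single σ a =>
    have h1 : cubicalBoundary n X (collapseHom (n + 1) X (Finsupp.single σ a)) =
        ∑ j : Fin (n + 1), (-1 : ℤ) ^ (j : ℕ) •
          ((QuotientAddGroup.mk (Finsupp.single
              ((σ.comp (collapse (n + 1))).comp (cubeFace j 1)) a) : CubicalChain n X) -
            QuotientAddGroup.mk (Finsupp.single
              ((σ.comp (collapse (n + 1))).comp (cubeFace j 0)) a)) := by
      rw [collapseHom_single]
      change QuotientAddGroup.mk' _ (cubeBoundary n X _) = _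
      simp only [cubeBoundary, oppositeFaces, AddMonoidHom.finsetSum_apply,
        AddMonoidHom.smul_apply, AddMonoidHom.sub_apply, map_sum, map_zsmul, map_sub,
        Finsupp.mapDomain.addMonoidHom_apply, Finsupp.mapDomain_single]
      rfl
    have h2 : collapseHom n X (singBoundary ℝ n X (Finsupp.single σ a)) =
        ∑ i : Fin (n + 2), (-1 : ℤ) ^ (i : ℕ) •
          (QuotientAddGroup.mk (Finsupp.single
            (σ.comp ((simplexFace i).comp (collapse n))) a) : CubicalChain n X) := by
      simp only [singBoundary, AddMonoidHom.finsetSum_apply, AddMonoidHom.smul_apply, map_sum,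
        map_zsmul, Finsupp.mapDomain.addMonoidHom_apply, Finsupp.mapDomain_single,
        collapseHom_single]
      rfl
    have hdeg : ∀ j : Fin n, (QuotientAddGroup.mk (Finsupp.single
        ((σ.comp (collapse (n + 1))).comp (cubeFace j.castSucc 0)) a) : CubicalChain n X) = 0 :=
      fun j => (QuotientAddGroup.eq_zero_iff _).2
        (single_mem_degenerateChains (isDegenerate_comp_collapse σ _ (Fin.castSucc_lt_last j).ne) a)
    rw [h1, h2]
    refine alternating_sum_sub _ _ _ (fun j => ?_) ?_ hdeg
    · rw [ContinuousMap.comp_assoc, collapse_comp_face_one]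
    · rw [ContinuousMap.comp_assoc, collapse_comp_face_zero_last]

/-- The natural chain map from singular to cubical chains that sends a singular simplex `σ` to the
singular cube `σ ∘ collapse`. It induces the canonical natural isomorphism between singular
and cubical singular homology. -/
def singToCubical : singular.{u} ℝ ⟶ cubical.{u} where
  app X := ChainComplex.ofHom (X := singComplex ℝ X) (Y := cubicalComplex X)
    (fun n => AddCommGrpCat.ofHom (collapseHom n X))
    (fun n => by
      simp only [singComplex, cubicalComplex, ChainComplex.of_d]
      exact AddCommGrpCat.hom_ext (AddMonoidHom.ext (cubicalBoundary_collapseHom n X)))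
  naturality X Y f := by
    ext n : 1
    refine AddCommGrpCat.hom_ext (AddMonoidHom.ext fun (c : SingChain ℝ n X) => ?_)
    refine congrArg QuotientAddGroup.mk (?_ :
      Finsupp.mapDomain (fun σ : C(Simplex n, Y) => σ.comp (collapse n))
          (Finsupp.mapDomain (fun σ : C(Simplex n, X) => f.hom.comp σ) c) =
        Finsupp.mapDomain (fun σ : C(Cube n, X) => f.hom.comp σ)
          (Finsupp.mapDomain (fun σ : C(Simplex n, X) => σ.comp (collapse n)) c))
    rw [← Finsupp.mapDomain_comp, ← Finsupp.mapDomain_comp]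
    rfl

/-! ### Relative chain complexes -/

section Functorial

variable (F G : TopCat.{u} ⥤ ChainComplex AddCommGrpCat.{u} ℕ)

/-- The inclusion of a subspace. -/
def incl {X : Type u} [TopologicalSpace X] (A : Set X) : TopCat.of A ⟶ TopCat.of X :=
  TopCat.ofHom ⟨Subtype.val, continuous_subtype_val⟩

/-- The chains of `X` that come from the subspace `A`. -/
def relSubgroup {X : Type u} [TopologicalSpace X] (A : Set X) (n : ℕ) :
    AddSubgroup ((F.obj (TopCat.of X)).X n) :=
  ((F.map (incl A)).f n).hom.range

theorem relSubgroup_le_comap_d {X : Type u} [TopologicalSpace X] (A : Set X) (i j : ℕ) :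
    relSubgroup F A i ≤ (relSubgroup F A j).comap ((F.obj (TopCat.of X)).d i j).hom := by
  rintro _ ⟨a, rfl⟩
  exact ⟨((F.obj (TopCat.of A)).d i j).hom a,
    ConcreteCategory.congr_hom ((F.map (incl A)).comm i j).symm a⟩

theorem relSubgroup_mono {X : Type u} [TopologicalSpace X] {A B : Set X} (h : A ⊆ B) (n : ℕ) :
    relSubgroup F A n ≤ relSubgroup F B n := by
  rintro _ ⟨a, rfl⟩
  let k : TopCat.of A ⟶ TopCat.of B := TopCat.ofHom ⟨Set.inclusion h, continuous_inclusion h⟩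
  have hk : incl A = k ≫ incl B := rfl
  refine ⟨((F.map k).f n).hom a, ?_⟩
  rw [hk, F.map_comp]
  rfl

theorem relSubgroup_le_comap_app {F G} (ψ : F ⟶ G) {X : Type u} [TopologicalSpace X] (A : Set X)
    (n : ℕ) :
    relSubgroup F A n ≤ (relSubgroup G A n).comap ((ψ.app (TopCat.of X)).f n).hom := by
  rintro _ ⟨a, rfl⟩
  exact ⟨((ψ.app (TopCat.of A)).f n).hom a, ConcreteCategory.congr_hom
    (congrArg (fun f => HomologicalComplex.Hom.f f n) (ψ.naturality (incl A)).symm) a⟩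

/-- The relative chain complex `F(X, A) = F(X) / F(A)`. -/
def relComplex {X : Type u} [TopologicalSpace X] (A : Set X) :
    ChainComplex AddCommGrpCat.{u} ℕ where
  X n := AddCommGrpCat.of ((F.obj (TopCat.of X)).X n ⧸ relSubgroup F A n)
  d i j := AddCommGrpCat.ofHom (QuotientAddGroup.map _ _ ((F.obj (TopCat.of X)).d i j).hom
    (relSubgroup_le_comap_d F A i j))
  shape i j h := by
    refine AddCommGrpCat.hom_ext (AddMonoidHom.ext fun c => ?_)
    obtain ⟨c, rfl⟩ := QuotientAddGroup.mk_surjective c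
    exact congrArg QuotientAddGroup.mk
      (ConcreteCategory.congr_hom ((F.obj (TopCat.of X)).shape i j h) c)
  d_comp_d' i j k _ _ := by
    refine AddCommGrpCat.hom_ext (AddMonoidHom.ext fun c => ?_)
    obtain ⟨c, rfl⟩ := QuotientAddGroup.mk_surjective c
    exact congrArg QuotientAddGroup.mk
      (ConcreteCategory.congr_hom ((F.obj (TopCat.of X)).d_comp_d i j k) c)

/-- The class in `F_n(X, A)` of a chain in `F_n(X)`. -/
def relMk {X : Type u} [TopologicalSpace X] (A : Set X) {n : ℕ}
    (c : (F.obj (TopCat.of X)).X n) : (relComplex F A).X n :=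
  (QuotientAddGroup.mk c : (F.obj (TopCat.of X)).X n ⧸ relSubgroup F A n)

/-- The chain map `F(X, A) ⟶ F(X, B)` for `A ⊆ B`. -/
def relMap {X : Type u} [TopologicalSpace X] {A B : Set X} (h : A ⊆ B) :
    relComplex F A ⟶ relComplex F B where
  f n := AddCommGrpCat.ofHom (QuotientAddGroup.map _ _ (AddMonoidHom.id _)
    (relSubgroup_mono F h n))
  comm' i j _ := by
    refine AddCommGrpCat.hom_ext (AddMonoidHom.ext fun c => ?_)
    obtain ⟨c, rfl⟩ := QuotientAddGroup.mk_surjective c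
    rfl

variable {F G}

/-- The chain map `F(X, A) ⟶ G(X, A)` induced by a natural chain map `F ⟶ G`. -/
def relTrans (ψ : F ⟶ G) {X : Type u} [TopologicalSpace X] (A : Set X) :
    relComplex F A ⟶ relComplex G A where
  f n := AddCommGrpCat.ofHom (QuotientAddGroup.map _ _ ((ψ.app (TopCat.of X)).f n).hom
    (relSubgroup_le_comap_app ψ A n))
  comm' i j _ := by
    refine AddCommGrpCat.hom_ext (AddMonoidHom.ext fun c => ?_)
    obtain ⟨c, rfl⟩ := QuotientAddGroup.mk_surjective c
    exact congrArg QuotientAddGroup.mk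
      (ConcreteCategory.congr_hom ((ψ.app (TopCat.of X)).comm i j) c)

/-- The quotient semi-norm on `F_n(X, A)` induced by a norm on `F_n(X)`. -/
def relNorm (N : ∀ (X : TopCat.{u}) (n : ℕ), (F.obj X).X n → ℝ≥0∞) {X : Type u}
    [TopologicalSpace X] (A : Set X) (n : ℕ) (c : (relComplex F A).X n) : ℝ≥0∞ :=
  ⨅ (b : (F.obj (TopCat.of X)).X n) (_ : relMk F A b = c), N (TopCat.of X) n b

/-! ### Locally finite chain complexes -/

variable (F)

/-- The compatible families in `∏ K, F_n(X, X ∖ K)`, where `K` runs through the compact subsets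
of `X`, i.e., the elements of the inverse limit of the `F_n(X, X ∖ K)`. -/
def lfSubgroup (X : Type u) [TopologicalSpace X] (n : ℕ) :
    AddSubgroup (∀ K : TopologicalSpace.Compacts X, (relComplex F (K : Set X)ᶜ).X n) where
  carrier := {c | ∀ (K L : TopologicalSpace.Compacts X) (h : (K : Set X) ⊆ L),
    ((relMap F (Set.compl_subset_compl.2 h)).f n).hom (c L) = c K}
  zero_mem' K L h := map_zero _
  add_mem' ha hb K L h := by
    rw [Pi.add_apply, map_add, ha K L h, hb K L h]
    rfl
  neg_mem' ha K L h := by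
    rw [Pi.neg_apply, map_neg, ha K L h]
    rfl

/-- The locally finite chain complex `F^lf(X)`, the inverse limit of the complexes `F(X, X ∖ K)`. -/
def lfComplex (X : Type u) [TopologicalSpace X] : ChainComplex AddCommGrpCat.{u} ℕ where
  X n := AddCommGrpCat.of (lfSubgroup F X n)
  d i j := AddCommGrpCat.ofHom
    { toFun := fun c => ⟨fun K => ((relComplex F (K : Set X)ᶜ).d i j).hom (c.1 K),
        fun K L h => (ConcreteCategory.congr_hom
            ((relMap F (Set.compl_subset_compl.2 h)).comm i j).symm (c.1 L)).trans
          (congrArg ((relComplex F (K : Set X)ᶜ).d i j).hom (c.2 K L h))⟩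
      map_zero' := Subtype.ext (funext fun K => map_zero _)
      map_add' := fun a b => Subtype.ext (funext fun K => map_add _ _ _) }
  shape i j h := by
    refine AddCommGrpCat.hom_ext (AddMonoidHom.ext fun c => Subtype.ext (funext fun K => ?_))
    exact ConcreteCategory.congr_hom ((relComplex F (K : Set X)ᶜ).shape i j h) (c.1 K)
  d_comp_d' i j k _ _ := by
    refine AddCommGrpCat.hom_ext (AddMonoidHom.ext fun c => Subtype.ext (funext fun K => ?_))
    exact ConcreteCategory.congr_hom ((relComplex F (K : Set X)ᶜ).d_comp_d i j k) (c.1 K)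

/-- The component in `F_n(X, X ∖ K)` of a locally finite chain. -/
def lfComponent {X : Type u} [TopologicalSpace X] {n : ℕ} (c : (lfComplex F X).X n)
    (K : TopologicalSpace.Compacts X) : (relComplex F (K : Set X)ᶜ).X n :=
  (show lfSubgroup F X n from c).1 K

/-- The chain map `F^lf(X) ⟶ F(X, X ∖ {x})`. -/
def lfRestrict {X : Type u} [TopologicalSpace X] (x : X) :
    lfComplex F X ⟶ relComplex F ({x}ᶜ : Set X) where
  f _ := AddCommGrpCat.ofHom
    { toFun := fun c => lfComponent F c ⟨{x}, isCompact_singleton⟩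
      map_zero' := rfl
      map_add' := fun _ _ => rfl }
  comm' _ _ _ := rfl

variable {F}

/-- The chain map `F^lf(X) ⟶ G^lf(X)` induced by a natural chain map `F ⟶ G`. -/
def lfTrans (ψ : F ⟶ G) (X : Type u) [TopologicalSpace X] : lfComplex F X ⟶ lfComplex G X where
  f n := AddCommGrpCat.ofHom
    { toFun := fun c => ⟨fun K => ((relTrans ψ (K : Set X)ᶜ).f n).hom (lfComponent F c K),
        fun K L h => by
          refine Eq.trans ?_ (congrArg ((relTrans ψ (K : Set X)ᶜ).f n).hom (c.2 K L h))
          obtain ⟨b, hb⟩ := QuotientAddGroup.mk_surjective (lfComponent F c L)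
          change ((relMap G (Set.compl_subset_compl.2 h)).f n).hom
              (((relTrans ψ (L : Set X)ᶜ).f n).hom (lfComponent F c L)) =
            ((relTrans ψ (K : Set X)ᶜ).f n).hom
              (((relMap F (Set.compl_subset_compl.2 h)).f n).hom (lfComponent F c L))
          rw [← hb]
          rfl⟩
      map_zero' := Subtype.ext (funext fun K => map_zero _)
      map_add' := fun a b => Subtype.ext (funext fun K => map_add _ _ _) }
  comm' i j _ := by
    refine AddCommGrpCat.hom_ext (AddMonoidHom.ext fun c => Subtype.ext (funext fun K => ?_))
    exact ConcreteCategory.congr_hom ((relTrans ψ (K : Set X)ᶜ).comm i j) (lfComponent F c K)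

/-- The (possibly infinite) semi-norm on `F_n^lf(X)`: the infimum of `lim_K N(b_K)` over all
`N`-Cauchy families `(b_K)_K` in `F_n(X)` such that `b_K` represents the component in
`F_n(X, X ∖ K)` for all compact `K`. For singular chains, this is the `ℓ¹`-norm of the
corresponding locally finite formal sum of singular simplices. -/
def lfNorm (N : ∀ (X : TopCat.{u}) (n : ℕ), (F.obj X).X n → ℝ≥0∞) (X : Type u)
    [TopologicalSpace X] (n : ℕ) (c : (lfComplex F X).X n) : ℝ≥0∞ :=
  ⨅ (b : TopologicalSpace.Compacts X → (F.obj (TopCat.of X)).X n)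
    (_ : ∀ K : TopologicalSpace.Compacts X, relMk F (K : Set X)ᶜ (b K) = lfComponent F c K)
    (_ : ∀ ε : ℝ≥0∞, 0 < ε → ∃ K₀, ∀ K L, K₀ ≤ K → K₀ ≤ L → N (TopCat.of X) n (b K - b L) < ε)
    (l : ℝ≥0∞) (_ : Tendsto (fun K => N (TopCat.of X) n (b K)) atTop (𝓝 l)), l

end Functorial

/-- The semi-norm on the homology of a chain complex induced by a norm on its `n`-chains: the
infimum of the norms of the cycles in the given class. -/
def homologyNorm (C : ChainComplex AddCommGrpCat.{u} ℕ) (n : ℕ) (N : C.X n → ℝ≥0∞)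
    (α : C.homology n) : ℝ≥0∞ :=
  ⨅ (z : C.cycles n) (_ : (C.homologyπ n).hom z = α), N ((C.iCycles n).hom z)

/-! ### Manifolds, orientations, and fundamental classes -/

/-- The closed half-space of `ℝ^n` of points with non-negative first coordinate; for `n = 0`, this
is the one-point space `ℝ^0`. -/
abbrev HalfSpace (n : ℕ) : Type :=
  {x : EuclideanSpace ℝ (Fin n) // ∀ i : Fin n, (i : ℕ) = 0 → 0 ≤ x i}

/-- Topological `n`-manifolds with (possibly empty) boundary. -/
structure IsManifoldWithBoundary (n : ℕ) (M : Type u) [TopologicalSpace M] : Prop where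
  t2 : T2Space M
  secondCountable : SecondCountableTopology M
  exists_chart : ∀ x : M, ∃ e : OpenPartialHomeomorph M (HalfSpace n), x ∈ e.source

/-- The boundary of an `n`-manifold: the points without an open neighbourhood that is
homeomorphic to an open subset of `ℝ^n`. -/
def manifoldBoundary (n : ℕ) (M : Type u) [TopologicalSpace M] : Set M :=
  {x | ¬ ∃ e : OpenPartialHomeomorph M (EuclideanSpace ℝ (Fin n)), x ∈ e.source}

/-- Singular homology `H_n(X, A; R)`. -/
abbrev relHomology (R : Type) [Ring R] {X : Type u} [TopologicalSpace X] (A : Set X) (n : ℕ) :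
    AddCommGrpCat.{u} :=
  (relComplex (singular.{u} R) A).homology n

/-- The map `H_n(X, A; R) ⟶ H_n(X, B; R)` for `A ⊆ B`. -/
abbrev relHomologyMap (R : Type) [Ring R] {X : Type u} [TopologicalSpace X] {A B : Set X}
    (h : A ⊆ B) (n : ℕ) : relHomology R A n ⟶ relHomology R B n :=
  HomologicalComplex.homologyMap (relMap (singular.{u} R) h) n

/-- An orientation of an `n`-manifold `M`: a locally consistent choice of generators of the local
homology groups `H_n(M, M ∖ {x}; ℤ)` at the interior points `x` of `M`. -/
structure ManifoldOrientation (n : ℕ) (M : Type u) [TopologicalSpace M] where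
  localClass : ∀ x : ((manifoldBoundary n M)ᶜ : Set M), relHomology ℤ ({x.1}ᶜ : Set M) n
  isGenerator : ∀ (x : ((manifoldBoundary n M)ᶜ : Set M))
    (β : relHomology ℤ ({x.1}ᶜ : Set M) n), ∃ k : ℤ, β = k • localClass x
  locallyConsistent : ∀ x : ((manifoldBoundary n M)ᶜ : Set M),
    ∃ (U : Set M) (hU : U ⊆ (manifoldBoundary n M)ᶜ) (μ : relHomology ℤ Uᶜ n),
      IsOpen U ∧ x.1 ∈ U ∧
      ∀ (y : M) (hy : y ∈ U), (relHomologyMap ℤ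
        (Set.compl_subset_compl.2 (Set.singleton_subset_iff.2 hy)) n).hom μ =
          localClass ⟨y, hU hy⟩

section Manifold

variable {n : ℕ} {M : Type u} [TopologicalSpace M]

/-- The local orientation at `x` with real coefficients, in `H_n(M, M ∖ {x}; ℝ)`. -/
def ManifoldOrientation.realLocalClass (o : ManifoldOrientation n M)
    (x : ((manifoldBoundary n M)ᶜ : Set M)) : relHomology ℝ ({x.1}ᶜ : Set M) n :=
  (HomologicalComplex.homologyMap (relTrans intToReal ({x.1}ᶜ : Set M)) n).hom (o.localClass x)

/-- The characterisation of the (real) fundamental class `[M, ∂M] ∈ H_n(M, ∂M; ℝ)`: for every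
interior point `x`, it is mapped to the local orientation at `x` in `H_n(M, M ∖ {x}; ℝ)`. On a
compact manifold, there is exactly one such class. -/
def IsFundamentalClass (o : ManifoldOrientation n M)
    (α : relHomology ℝ (manifoldBoundary n M) n) : Prop :=
  ∀ x : ((manifoldBoundary n M)ᶜ : Set M),
    (relHomologyMap ℝ (Set.subset_compl_singleton_iff.2 x.2) n).hom α = o.realLocalClass x

/-- The characterisation of the locally finite (real) fundamental class `[M] ∈ H_n^lf(M; ℝ)` of a
manifold without boundary: for every point `x`, it is mapped to the local orientation at `x` in
`H_n(M, M ∖ {x}; ℝ)`. There is exactly one such class. -/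
def IsLfFundamentalClass (o : ManifoldOrientation n M)
    (α : (lfComplex (singular.{u} ℝ) M).homology n) : Prop :=
  ∀ x : ((manifoldBoundary n M)ᶜ : Set M),
    (HomologicalComplex.homologyMap (lfRestrict (singular.{u} ℝ) x.1) n).hom α =
      o.realLocalClass x

/-- The simplicial volume `‖M, ∂M‖`, the `ℓ¹`-semi-norm of the fundamental class. -/
def simplicialVolume (o : ManifoldOrientation n M) : ℝ≥0∞ :=
  ⨅ (α : relHomology ℝ (manifoldBoundary n M) n) (_ : IsFundamentalClass o α),
    homologyNorm _ n (relNorm singNorm (manifoldBoundary n M) n) α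

/-- The cubical simplicial volume `‖M, ∂M‖^□`, the cubical `ℓ¹`-semi-norm of the cubical
fundamental class, i.e., of the class in `H_n^□(M, ∂M; ℝ)` that corresponds to the fundamental
class. -/
def cubicalSimplicialVolume (o : ManifoldOrientation n M) : ℝ≥0∞ :=
  ⨅ (α : relHomology ℝ (manifoldBoundary n M) n) (_ : IsFundamentalClass o α),
    homologyNorm _ n (relNorm cubicalNorm (manifoldBoundary n M) n)
      ((HomologicalComplex.homologyMap (relTrans singToCubical (manifoldBoundary n M)) n).hom α)

/-- The locally finite simplicial volume `‖M‖^lf`. -/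
def lfSimplicialVolume (o : ManifoldOrientation n M) : ℝ≥0∞ :=
  ⨅ (α : (lfComplex (singular.{u} ℝ) M).homology n) (_ : IsLfFundamentalClass o α),
    homologyNorm _ n (lfNorm singNorm M n) α

/-- The locally finite cubical simplicial volume `‖M‖^{□,lf}`. -/
def lfCubicalSimplicialVolume (o : ManifoldOrientation n M) : ℝ≥0∞ :=
  ⨅ (α : (lfComplex (singular.{u} ℝ) M).homology n) (_ : IsLfFundamentalClass o α),
    homologyNorm _ n (lfNorm cubicalNorm M n)
      ((HomologicalComplex.homologyMap (lfTrans singToCubical M) n).hom α)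

end Manifold

end CubicalVolume

end

noncomputable section

namespace CubicalVolume

universe v w

/-! ### Cones of singular chains -/

/-! Two natural chain maps of bounded norm compare the complexes. Precomposition with the collapse
turns one simplex into one cube, so `singToCubical` does not increase norms
(`cubicalNorm_singToCubical_le`). Conversely, `cubicalToSing` replaces every cube by the image of a
fixed chain `cubeTriangulation n`, built recursively: triangulate the faces of the cube and cone off
the result from the vertex `0`. The `(n + 1)`-cube has `2 (n + 1)` faces and coning does not
increase the norm, so this chain has norm at most `2 ^ n * n!` (`l1Norm_cubeTriangulation_le`). It
defines a chain map because the cone over a cycle bounds that cycle, and it kills degenerate cubes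
because the linear contractions of cubes commute with coordinate projections
(`push_cubeProj_cubeTriangulation`).

The composite from singular chains to cubical chains and back is natural and is the identity in
degree `0`. As simplices are contractible, the method of acyclic models yields a natural chain
homotopy to the identity (`homotopySingToCubical`). By naturality it preserves the chains of
subspaces, so it descends to relative complexes and to their inverse limits. Hence triangulating is
a left inverse, in homology, of the canonical map to cubical homology; the other composite plays no
role.

Consequently every relative or locally finite class has cubical semi-norm at most its singular
semi-norm, and singular semi-norm at most `2 ^ n * n!` times the cubical one. Applying this to the
fundamental classes gives both statements. The locally finite case needs one more observation: the
image of a Cauchy family is Cauchy, and its norms converge (`lfNorm_lfTrans_le`). -/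

/-- The map `(t, s) ↦ (t, (1 - t) s)` that exhibits the `(n + 1)`-simplex as the cone over its
zeroth face. -/
def simplexJoin (n : ℕ) : C(unitInterval × Simplex n, Simplex (n + 1)) where
  toFun p := ⟨Fin.cons (p.1 : ℝ) fun i => (1 - (p.1 : ℝ)) * p.2 i, by
    constructor
    · intro i
      refine Fin.cases ?_ (fun j => ?_) i
      · exact p.1.2.1
      · exact mul_nonneg (sub_nonneg.2 p.1.2.2) (p.2.2.1 j)
    · rw [Fin.sum_univ_succ]
      simp only [Fin.cons_zero, Fin.cons_succ, ← Finset.mul_sum]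
      have : ∑ i, p.2 i = 1 := p.2.2.2
      rw [this]
      ring⟩
  continuous_toFun := by
    refine Continuous.subtype_mk (continuous_pi fun i => ?_) _
    refine Fin.cases ?_ (fun j => ?_) i
    · simp only [Fin.cons_zero]
      fun_prop
    · simp only [Fin.cons_succ]
      have : Continuous fun p : unitInterval × Simplex n => p.2 j :=
        (continuous_apply j).comp (continuous_subtype_val.comp continuous_snd)
      fun_prop

theorem simplexJoin_zero {n : ℕ} (t : unitInterval) (s : Simplex n) :
    simplexJoin n (t, s) 0 = t := rfl

theorem simplexJoin_succ {n : ℕ} (t : unitInterval) (s : Simplex n) (i : Fin (n + 1)) :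
    simplexJoin n (t, s) i.succ = (1 - (t : ℝ)) * s i := rfl

theorem simplexJoin_surjective (n : ℕ) : Function.Surjective (simplexJoin n) := by
  intro y
  have hsum : y 0 + ∑ i : Fin (n + 1), y i.succ = 1 := by
    rw [← Fin.sum_univ_succ]
    exact y.2.2
  have hnn : ∀ i, 0 ≤ y i := y.2.1
  have hs : 0 ≤ ∑ i : Fin (n + 1), y i.succ := Finset.sum_nonneg fun i _ => hnn _
  have h1 : y 0 ≤ 1 := by linarith
  by_cases h : y 0 = 1
  -- At the apex all other coordinates vanish, so the point of the base can be chosen arbitrarily.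
  · refine ⟨(1, stdSimplex.vertex 0), ?_⟩
    ext i
    refine Fin.cases ?_ (fun j => ?_) i
    · rw [simplexJoin_zero, h]
      rfl
    · rw [simplexJoin_succ]
      have h0 : ∑ i : Fin (n + 1), y i.succ = 0 := by linarith
      rw [(Finset.sum_eq_zero_iff_of_nonneg fun i _ => hnn _).1 h0 j (Finset.mem_univ j)]
      simp
  · have hne : 1 - y 0 ≠ 0 := sub_ne_zero.2 (Ne.symm h)
    refine ⟨(⟨y 0, hnn 0, h1⟩, ⟨fun i => y i.succ / (1 - y 0), fun i =>
      div_nonneg (hnn _) (sub_nonneg.2 h1), ?_⟩), ?_⟩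
    · rw [← Finset.sum_div, div_eq_one_iff_eq hne]
      linarith
    · ext i
      refine Fin.cases ?_ (fun j => ?_) i
      · rfl
      · rw [simplexJoin_succ]
        exact mul_div_cancel₀ _ hne

/-- A continuous map from a compact space to a Hausdorff space is closed. This allows maps on the
simplex to be defined on the prism. -/
theorem isQuotientMap_simplexJoin (n : ℕ) : IsQuotientMap (simplexJoin n) :=
  (simplexJoin n).continuous.isClosedMap.isQuotientMap (simplexJoin n).continuous
    (simplexJoin_surjective n)

theorem simplexFace_zero_eq_join {n : ℕ} (s : Simplex n) :
    simplexFace 0 s = simplexJoin n (0, s) := by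
  ext i
  refine Fin.cases ?_ (fun j => ?_) i
  · rw [simplexFace_same, simplexJoin_zero]
    rfl
  · rw [simplexJoin_succ, ← Fin.succAbove_zero, simplexFace_succAbove]
    simp

theorem simplexFace_succ_join {n : ℕ} (i : Fin (n + 2)) (t : unitInterval) (s : Simplex n) :
    simplexFace i.succ (simplexJoin n (t, s)) = simplexJoin (n + 1) (t, simplexFace i s) := by
  ext k
  obtain rfl | ⟨k, rfl⟩ := Fin.eq_self_or_eq_succAbove i.succ k
  · rw [simplexFace_same, simplexJoin_succ, simplexFace_same, mul_zero]
  · rw [simplexFace_succAbove]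
    refine Fin.cases ?_ (fun j => ?_) k
    · rw [Fin.succ_succAbove_zero]
      rfl
    · rw [Fin.succ_succAbove_succ, simplexJoin_succ, simplexJoin_succ, simplexFace_succAbove]

theorem simplexFace_one_eq_join (s : Simplex 0) :
    simplexFace 1 s = simplexJoin 0 (1, s) := by
  ext i
  refine Fin.cases ?_ (fun j => ?_) i
  · rw [simplexJoin_zero, show (0 : Fin 2) = Fin.succAbove 1 0 from rfl, simplexFace_succAbove]
    simp
  · rw [simplexJoin_succ, Subsingleton.elim j 0, show Fin.succ (0 : Fin 1) = (1 : Fin 2) from rfl,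
      simplexFace_same]
    simp

section Cone

variable {X : Type v} [TopologicalSpace X] {b : X}
  (H : (ContinuousMap.id X).Homotopy (ContinuousMap.const X b))

/-- The cone over a singular simplex with respect to a contraction. -/
def coneSimplex {n : ℕ} (σ : C(Simplex n, X)) : C(Simplex (n + 1), X) :=
  (isQuotientMap_simplexJoin n).lift
    (H.toContinuousMap.comp ((ContinuousMap.id unitInterval).prodMap σ)) (by
      rintro ⟨t, s⟩ ⟨t', s'⟩ h
      have h0 : t = t' := Subtype.ext (congrArg (fun y : Simplex (n + 1) => y 0) h)
      subst h0
      change H (t, σ s) = H (t, σ s')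
      -- The join forgets `s` only at the apex `t = 1`, and there the contraction is constant.
      by_cases ht : t = 1
      · rw [ht, H.apply_one, H.apply_one]
        rfl
      · congr 3
        ext i
        have hi := congrArg (fun y : Simplex (n + 1) => y i.succ) h
        simp only [simplexJoin_succ] at hi
        refine mul_left_cancel₀ (sub_ne_zero.2 fun h1 => ht (Subtype.ext h1.symm)) hi)

theorem coneSimplex_join {n : ℕ} (σ : C(Simplex n, X)) (t : unitInterval) (s : Simplex n) :
    coneSimplex H σ (simplexJoin n (t, s)) = H (t, σ s) := by
  have h : (coneSimplex H σ).comp (simplexJoin n) =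
      H.toContinuousMap.comp ((ContinuousMap.id unitInterval).prodMap σ) :=
    (isQuotientMap_simplexJoin n).lift_comp _ _
  exact DFunLike.congr_fun h (t, s)

theorem coneSimplex_face_zero {n : ℕ} (σ : C(Simplex n, X)) :
    (coneSimplex H σ).comp (simplexFace 0) = σ := by
  ext1 s
  rw [ContinuousMap.comp_apply, simplexFace_zero_eq_join, coneSimplex_join, H.apply_zero]
  rfl

theorem coneSimplex_face_succ {n : ℕ} (σ : C(Simplex (n + 1), X)) (i : Fin (n + 2)) :
    (coneSimplex H σ).comp (simplexFace i.succ) = coneSimplex H (σ.comp (simplexFace i)) := by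
  ext1 y
  obtain ⟨⟨t, s⟩, rfl⟩ := simplexJoin_surjective n y
  rw [ContinuousMap.comp_apply, simplexFace_succ_join, coneSimplex_join, coneSimplex_join]
  rfl

theorem coneSimplex_face_one (σ : C(Simplex 0, X)) :
    (coneSimplex H σ).comp (simplexFace 1) = ContinuousMap.const _ b := by
  ext1 s
  rw [ContinuousMap.comp_apply, simplexFace_one_eq_join, coneSimplex_join, H.apply_one]
  rfl

theorem comp_coneSimplex {Y : Type w} [TopologicalSpace Y] {b' : Y}
    (H' : (ContinuousMap.id Y).Homotopy (ContinuousMap.const Y b')) (f : C(X, Y))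
    (hf : ∀ t x, f (H (t, x)) = H' (t, f x)) {n : ℕ} (σ : C(Simplex n, X)) :
    f.comp (coneSimplex H σ) = coneSimplex H' (f.comp σ) := by
  ext1 y
  obtain ⟨⟨t, s⟩, rfl⟩ := simplexJoin_surjective n y
  rw [ContinuousMap.comp_apply, coneSimplex_join, coneSimplex_join, hf]
  rfl

/-- The cone over a singular chain with respect to a contraction. -/
def cone (n : ℕ) : SingChain ℝ n X →ₗ[ℝ] SingChain ℝ (n + 1) X :=
  Finsupp.lmapDomain ℝ ℝ (coneSimplex H)

theorem cone_single {n : ℕ} (σ : C(Simplex n, X)) (a : ℝ) :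
    cone H n (Finsupp.single σ a) = Finsupp.single (coneSimplex H σ) a :=
  Finsupp.mapDomain_single

end Cone

theorem singBoundary_single {X : Type v} [TopologicalSpace X] {n : ℕ} (σ : C(Simplex (n + 1), X))
    (a : ℝ) : singBoundary ℝ n X (Finsupp.single σ a) =
      ∑ i : Fin (n + 2), (-1 : ℤ) ^ (i : ℕ) • Finsupp.single (σ.comp (simplexFace i)) a := by
  simp [singBoundary, AddMonoidHom.finsetSum_apply]

/-- The zeroth face of a cone is its base and the other faces are the cones over the faces of the
base; the index shift produces the minus sign. In particular, every cycle of positive degree is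
bounded by its cone. -/
theorem singBoundary_cone {X : Type v} [TopologicalSpace X] {b : X}
    (H : (ContinuousMap.id X).Homotopy (ContinuousMap.const X b)) {n : ℕ}
    (c : SingChain ℝ (n + 1) X) :
    singBoundary ℝ (n + 1) X (cone H (n + 1) c) = c - cone H n (singBoundary ℝ n X c) := by
  induction c using Finsupp.induction_linear with
  | zero => simp
  | add f g hf hg => simp only [map_add, hf, hg]; abel
  | single σ a =>
    rw [cone_single, singBoundary_single, Fin.sum_univ_succ, coneSimplex_face_zero,
      singBoundary_single]
    simp only [map_sum, map_zsmul, cone_single, coneSimplex_face_succ, Fin.val_zero, pow_zero,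
      one_smul, Fin.val_succ, pow_succ, mul_neg, mul_one, neg_smul, Finset.sum_neg_distrib,
      sub_eq_add_neg]

/-- In degree `0` the remaining face is the constant simplex at the apex, so only chains with
coefficient sum zero are bounded by their cones. -/
theorem singBoundary_cone_zero {X : Type v} [TopologicalSpace X] {b : X}
    (H : (ContinuousMap.id X).Homotopy (ContinuousMap.const X b)) (c : SingChain ℝ 0 X) :
    singBoundary ℝ 0 X (cone H 0 c) =
      c - Finsupp.single (ContinuousMap.const _ b) (c.sum fun _ a => a) := by
  induction c using Finsupp.induction_linear with
  | zero => simp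
  | add f g hf hg =>
    rw [Finsupp.sum_add_index' (fun _ => rfl) (fun _ _ _ => rfl), Finsupp.single_add]
    simp only [map_add, hf, hg]
    abel
  | single σ a =>
    rw [cone_single, singBoundary_single, Fin.sum_univ_two, coneSimplex_face_zero,
      coneSimplex_face_one, Finsupp.sum_single_index rfl]
    simp [sub_eq_add_neg]

/-! ### Chains on models -/

/-- The map on singular chains induced by a continuous map, across universes. -/
def push {X : Type v} {Y : Type w} [TopologicalSpace X] [TopologicalSpace Y] {n : ℕ} (f : C(X, Y)) :
    SingChain ℝ n X →ₗ[ℝ] SingChain ℝ n Y :=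
  Finsupp.lmapDomain ℝ ℝ fun σ => f.comp σ

section Push

variable {X : Type v} {Y : Type w} [TopologicalSpace X] [TopologicalSpace Y] {n : ℕ}

theorem push_single (f : C(X, Y)) (σ : C(Simplex n, X)) (a : ℝ) :
    push f (Finsupp.single σ a) = Finsupp.single (f.comp σ) a :=
  Finsupp.mapDomain_single

theorem push_comp {Z : Type*} [TopologicalSpace Z] (g : C(Y, Z)) (f : C(X, Y))
    (c : SingChain ℝ n X) : push (g.comp f) c = push g (push f c) :=
  Finsupp.mapDomain_comp (f := fun σ => f.comp σ) (g := fun σ => g.comp σ)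

theorem singBoundary_push (f : C(X, Y)) (c : SingChain ℝ (n + 1) X) :
    singBoundary ℝ n Y (push f c) = push f (singBoundary ℝ n X c) := by
  induction c using Finsupp.induction_linear with
  | zero => simp
  | add f g hf hg => simp only [map_add, hf, hg]
  | single σ a =>
    simp only [push_single, singBoundary_single, map_sum, map_zsmul, ContinuousMap.comp_assoc]

theorem singBoundary_smul (a : ℝ) (c : SingChain ℝ (n + 1) X) :
    singBoundary ℝ n X (a • c) = a • singBoundary ℝ n X c := by
  simp only [singBoundary, AddMonoidHom.finsetSum_apply, AddMonoidHom.smul_apply,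
    Finsupp.mapDomain.addMonoidHom_apply, Finsupp.mapDomain_smul, Finset.smul_sum,
    smul_comm a]

/-- Used for the coordinate projections of cubes, which intertwine the linear contractions. -/
theorem push_cone {b : X} {b' : Y} (H : (ContinuousMap.id X).Homotopy (ContinuousMap.const X b))
    (H' : (ContinuousMap.id Y).Homotopy (ContinuousMap.const Y b')) (f : C(X, Y))
    (hf : ∀ t x, f (H (t, x)) = H' (t, f x)) (c : SingChain ℝ n X) :
    push f (cone H n c) = cone H' n (push f c) := by
  induction c using Finsupp.induction_linear with
  | zero => simp
  | add f g hf hg => simp only [map_add, hf, hg]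
  | single σ a => rw [cone_single, push_single, push_single, cone_single, comp_coneSimplex H H' f hf]

end Push

/-- The natural map on chains that is determined by its value `u` on the model `P`. -/
def evalModel {P : Type} [TopologicalSpace P] {m : ℕ} (u : SingChain ℝ m P) (X : Type v)
    [TopologicalSpace X] : (C(P, X) →₀ ℝ) →ₗ[ℝ] SingChain ℝ m X :=
  Finsupp.linearCombination ℝ fun c => push c u

section EvalModel

variable {P : Type} [TopologicalSpace P] {m : ℕ} (u : SingChain ℝ m P) {X : Type v}
  [TopologicalSpace X]

theorem evalModel_single (c : C(P, X)) (a : ℝ) :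
    evalModel u X (Finsupp.single c a) = a • push c u :=
  Finsupp.linearCombination_single ℝ a c

theorem evalModel_zero (q : C(P, X) →₀ ℝ) : evalModel (0 : SingChain ℝ m P) X q = 0 := by
  simp [evalModel, Finsupp.linearCombination_apply]

theorem push_evalModel {Y : Type w} [TopologicalSpace Y] (f : C(X, Y)) (q : C(P, X) →₀ ℝ) :
    push f (evalModel u X q) = evalModel u Y (Finsupp.mapDomain (fun c => f.comp c) q) := by
  induction q using Finsupp.induction_linear with
  | zero => simp
  | add f g hf hg => simp only [map_add, hf, hg, Finsupp.mapDomain_add]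
  | single σ a =>
    rw [evalModel_single, Finsupp.mapDomain_single, evalModel_single, map_smul, push_comp]

end EvalModel

theorem cubeBoundary_single {X : Type v} [TopologicalSpace X] {n : ℕ} (c : C(Cube (n + 1), X))
    (a : ℝ) : cubeBoundary n X (Finsupp.single c a) =
      ∑ j : Fin (n + 1), (-1 : ℤ) ^ (j : ℕ) • (Finsupp.single (c.comp (cubeFace j 1)) a -
        Finsupp.single (c.comp (cubeFace j 0)) a) := by
  simp [cubeBoundary, oppositeFaces, AddMonoidHom.finsetSum_apply]

theorem cubeBoundary_mapDomain {X : Type v} {Y : Type w} [TopologicalSpace X] [TopologicalSpace Y]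
    {n : ℕ} (f : C(X, Y)) (q : CubeChain (n + 1) X) :
    cubeBoundary n Y (Finsupp.mapDomain (fun c => f.comp c) q) =
      Finsupp.mapDomain (fun c => f.comp c) (cubeBoundary n X q) := by
  simp only [← Finsupp.mapDomain.addMonoidHom_apply]
  induction q using Finsupp.induction_linear with
  | zero => simp
  | add f g hf hg => simp only [map_add, hf, hg]
  | single σ a =>
    simp only [Finsupp.mapDomain.addMonoidHom_apply, Finsupp.mapDomain_single]
    simp only [← Finsupp.mapDomain.addMonoidHom_apply, cubeBoundary_single, map_sum, map_zsmul,
      map_sub]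
    simp only [Finsupp.mapDomain.addMonoidHom_apply, Finsupp.mapDomain_single,
      ContinuousMap.comp_assoc]

theorem cubeBoundary_smul {X : Type v} [TopologicalSpace X] {n : ℕ} (a : ℝ)
    (q : CubeChain (n + 1) X) : cubeBoundary n X (a • q) = a • cubeBoundary n X q := by
  simp only [cubeBoundary, oppositeFaces, AddMonoidHom.finsetSum_apply, AddMonoidHom.smul_apply,
    AddMonoidHom.sub_apply, Finsupp.mapDomain.addMonoidHom_apply, Finsupp.mapDomain_smul,
    Finset.smul_sum, smul_comm a, smul_sub]

/-! ### The triangulation of the cube -/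

/-- The linear contraction of the cube to the vertex `0`. -/
def cubeContraction (n : ℕ) :
    (ContinuousMap.id (Cube n)).Homotopy (ContinuousMap.const (Cube n) 0) where
  toFun p i := unitInterval.symm p.1 * p.2 i
  continuous_toFun := by fun_prop
  map_zero_left x := by funext i; simp
  map_one_left x := by funext i; simp

/-- The chain of the `n`-cube that is obtained by iteratively coning off the faces from the
vertex `0`. -/
def cubeTriangulation : ∀ n : ℕ, SingChain ℝ n (Cube n)
  | 0 => Finsupp.single (ContinuousMap.const _ 0) 1
  | n + 1 => cone (cubeContraction (n + 1)) n (evalModel (cubeTriangulation n) (Cube (n + 1))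
      (cubeBoundary n (Cube (n + 1)) (Finsupp.single (ContinuousMap.id _) 1)))

/-- Both sides are linear and natural, and each cube is the image of the identity cube, so the
identity on the model suffices. -/
theorem singBoundary_evalModel_cube {n : ℕ} {u : SingChain ℝ (n + 1) (Cube (n + 1))}
    {v : SingChain ℝ n (Cube n)}
    (h : singBoundary ℝ n (Cube (n + 1)) u = evalModel v (Cube (n + 1))
      (cubeBoundary n (Cube (n + 1)) (Finsupp.single (ContinuousMap.id _) 1)))
    {X : Type w} [TopologicalSpace X] (q : CubeChain (n + 1) X) :
    singBoundary ℝ n X (evalModel u X q) = evalModel v X (cubeBoundary n X q) := by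
  induction q using Finsupp.induction_linear with
  | zero => simp
  | add f g hf hg => simp only [map_add, hf, hg]
  | single c a =>
    have : Finsupp.single c a =
        a • Finsupp.mapDomain (fun d => c.comp d) (Finsupp.single (ContinuousMap.id _) (1 : ℝ)) := by
      rw [Finsupp.mapDomain_single, Finsupp.smul_single, smul_eq_mul, mul_one,
        ContinuousMap.comp_id]
    rw [evalModel_single, singBoundary_smul, singBoundary_push, h, push_evalModel, this,
      cubeBoundary_smul, map_smul, cubeBoundary_mapDomain]

theorem singBoundary_cubeTriangulation (n : ℕ) :
    singBoundary ℝ n (Cube (n + 1)) (cubeTriangulation (n + 1)) =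
      evalModel (cubeTriangulation n) (Cube (n + 1))
        (cubeBoundary n (Cube (n + 1)) (Finsupp.single (ContinuousMap.id _) 1)) := by
  induction n with
  | zero =>
    change singBoundary ℝ 0 (Cube 1) (cone _ 0 _) = _
    -- The error term is the coefficient sum of the boundary of the interval, which is `1 - 1`.
    rw [singBoundary_cone_zero, sub_eq_self, Finsupp.single_eq_zero]
    rw [cubeBoundary_single, Fin.sum_univ_one, Fin.val_zero, pow_zero, one_smul, map_sub,
      evalModel_single, evalModel_single, cubeTriangulation, push_single, push_single, one_smul,
      one_smul, Finsupp.sum_sub_index (fun _ _ _ => rfl), Finsupp.sum_single_index rfl,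
      Finsupp.sum_single_index rfl, sub_self]
  | succ n ih =>
    -- The triangulated boundary is a cycle: by induction its boundary is the triangulation of `∂∂ =
    -- 0`. So the correction term of the cone formula vanishes.
    rw [cubeTriangulation, singBoundary_cone, singBoundary_evalModel_cube ih,
      cubeBoundary_cubeBoundary]
    simp

theorem singBoundary_evalModel_cubeTriangulation {n : ℕ} {X : Type v} [TopologicalSpace X]
    (q : CubeChain (n + 1) X) :
    singBoundary ℝ n X (evalModel (cubeTriangulation (n + 1)) X q) =
      evalModel (cubeTriangulation n) X (cubeBoundary n X q) :=
  singBoundary_evalModel_cube (singBoundary_cubeTriangulation n) q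

/-- The projection of the cube along the `j`-th coordinate. -/
def cubeProj {n : ℕ} (j : Fin (n + 1)) : C(Cube (n + 1), Cube n) :=
  ⟨fun x k => x (j.succAbove k), by fun_prop⟩

/-- On the `k`-th face, the `j`-th coordinate is still a free coordinate of the smaller cube, and
the projection forgets it. -/
theorem isDegenerate_cubeProj_comp_cubeFace {n : ℕ} {j k : Fin (n + 1)} (h : j ≠ k)
    (e : unitInterval) : IsDegenerate ((cubeProj j).comp (cubeFace k e)) := by
  obtain ⟨i, rfl⟩ := Fin.exists_succAbove_eq h
  refine ⟨i, fun x t => funext fun l => ?_⟩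
  change cubeFace k e (Function.update x i t) _ = cubeFace k e x _
  have hl : (k.succAbove i).succAbove l ≠ k.succAbove i := Fin.succAbove_ne _ _
  obtain hm | ⟨m, hm⟩ := Fin.eq_self_or_eq_succAbove k ((k.succAbove i).succAbove l)
  · rw [hm, cubeFace_same, cubeFace_same]
  · rw [hm, cubeFace_succAbove, cubeFace_succAbove, Function.update_of_ne]
    rintro rfl
    exact hl hm

theorem cubeProj_comp_cubeFace {n : ℕ} (j : Fin (n + 1)) (e : unitInterval) :
    (cubeProj j).comp (cubeFace j e) = ContinuousMap.id _ := by
  ext1 x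
  exact funext fun k => cubeFace_succAbove j e x k

theorem IsDegenerate.exists_eq_comp_cubeProj {n : ℕ} {X : Type v} [TopologicalSpace X]
    {c : C(Cube (n + 1), X)} (hc : IsDegenerate c) :
    ∃ (j : Fin (n + 1)) (d : C(Cube n, X)), c = d.comp (cubeProj j) := by
  obtain ⟨j, hj⟩ := hc
  refine ⟨j, c.comp (cubeFace j 0), ContinuousMap.ext fun x => ?_⟩
  rw [← hj x 0]
  refine congrArg c (funext fun k => ?_)
  obtain rfl | ⟨k, rfl⟩ := Fin.eq_self_or_eq_succAbove j k
  · rw [Function.update_self, cubeFace_same]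
  · rw [Function.update_of_ne (Fin.succAbove_ne _ _), cubeFace_succAbove]
    rfl

/-- The projection commutes with coning, so it suffices that the projected boundary of the cube has
zero triangulation. The two faces orthogonal to the `j`-th direction both project to the identity
and cancel. All other faces project to degenerate cubes of one dimension less, which vanish by
induction. -/
theorem push_cubeProj_cubeTriangulation (n : ℕ) (j : Fin (n + 1)) :
    push (cubeProj j) (cubeTriangulation (n + 1)) = 0 := by
  induction n with
  | zero =>
    rw [cubeTriangulation, push_cone _ (cubeContraction 0) _ (fun _ _ => rfl), push_evalModel,
      ← cubeBoundary_mapDomain, Finsupp.mapDomain_single, cubeBoundary_single]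
    have h : ∀ e e' : unitInterval, ((cubeProj j).comp (ContinuousMap.id _)).comp (cubeFace 0 e) =
        ((cubeProj j).comp (ContinuousMap.id _)).comp (cubeFace 0 e') := fun e e' =>
      ContinuousMap.ext fun x => Subsingleton.elim _ _
    rw [Fin.sum_univ_one, h 1 0, sub_self, smul_zero, map_zero, map_zero]
  | succ n ih =>
    have hdeg : ∀ c : C(Cube (n + 1), Cube (n + 1)), IsDegenerate c →
        push c (cubeTriangulation (n + 1)) = 0 := by
      intro c hc
      obtain ⟨i, d, rfl⟩ := hc.exists_eq_comp_cubeProj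
      rw [push_comp, ih, map_zero]
    rw [cubeTriangulation, push_cone _ (cubeContraction (n + 1)) _ (fun _ _ => rfl),
      push_evalModel, ← cubeBoundary_mapDomain, Finsupp.mapDomain_single, cubeBoundary_single,
      ContinuousMap.comp_id, map_sum, Finset.sum_eq_zero, map_zero]
    intro k _
    rw [map_zsmul, map_sub, evalModel_single, evalModel_single, one_smul, one_smul]
    by_cases hk : j = k
    · rw [hk, cubeProj_comp_cubeFace, cubeProj_comp_cubeFace, sub_self, smul_zero]
    · rw [hdeg _ (isDegenerate_cubeProj_comp_cubeFace hk 1),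
        hdeg _ (isDegenerate_cubeProj_comp_cubeFace hk 0), sub_self, smul_zero]

theorem push_cubeTriangulation_of_isDegenerate {n : ℕ} {X : Type v} [TopologicalSpace X]
    {c : C(Cube n, X)} (hc : IsDegenerate c) : push c (cubeTriangulation n) = 0 := by
  obtain _ | n := n
  -- A `0`-cube has no coordinate to be independent of.
  · exact hc.choose.elim0
  obtain ⟨i, d, rfl⟩ := hc.exists_eq_comp_cubeProj
  rw [push_comp, push_cubeProj_cubeTriangulation, map_zero]

/-! ### From cubical to singular chains -/

/-- The map from cubical to singular chains that triangulates each singular cube. -/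
def triangulate (n : ℕ) (X : Type v) [TopologicalSpace X] : CubicalChain n X →+ SingChain ℝ n X :=
  QuotientAddGroup.lift (degenerateChains n X)
    (evalModel (cubeTriangulation n) X).toAddMonoidHom <| by
      refine (AddSubgroup.closure_le _).2 ?_
      rintro _ ⟨c, a, hc, rfl⟩
      change evalModel (cubeTriangulation n) X (Finsupp.single c a) = 0
      rw [evalModel_single, push_cubeTriangulation_of_isDegenerate hc, smul_zero]

theorem triangulate_mk {n : ℕ} {X : Type v} [TopologicalSpace X] (q : CubeChain n X) :
    triangulate n X (QuotientAddGroup.mk q) = evalModel (cubeTriangulation n) X q := rfl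

theorem singBoundary_triangulate {n : ℕ} {X : Type v} [TopologicalSpace X]
    (c : CubicalChain (n + 1) X) :
    singBoundary ℝ n X (triangulate (n + 1) X c) = triangulate n X (cubicalBoundary n X c) := by
  obtain ⟨q, rfl⟩ := QuotientAddGroup.mk_surjective c
  exact singBoundary_evalModel_cubeTriangulation q

/-- The composite is again determined by one chain on the model simplex; its naturality is then that
of `evalModel`. -/
theorem triangulate_collapseHom {n : ℕ} {X : Type v} [TopologicalSpace X] (c : SingChain ℝ n X) :
    triangulate n X (collapseHom n X c) =
      evalModel (push (collapse n) (cubeTriangulation n)) X c := by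
  induction c using Finsupp.induction_linear with
  | zero => simp
  | add f g hf hg => simp only [map_add, hf, hg]
  | single σ a =>
    rw [collapseHom_single, triangulate_mk, evalModel_single, evalModel_single, push_comp]

theorem singBoundary_triangulate_collapseHom {n : ℕ} {X : Type v} [TopologicalSpace X]
    (c : SingChain ℝ (n + 1) X) :
    singBoundary ℝ n X (triangulate (n + 1) X (collapseHom (n + 1) X c)) =
      triangulate n X (collapseHom n X (singBoundary ℝ n X c)) := by
  rw [singBoundary_triangulate, cubicalBoundary_collapseHom]

theorem triangulate_collapseHom_zero {X : Type v} [TopologicalSpace X] (c : SingChain ℝ 0 X) :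
    triangulate 0 X (collapseHom 0 X c) = c := by
  induction c using Finsupp.induction_linear with
  | zero => simp
  | add f g hf hg => simp only [map_add, hf, hg]
  | single σ a =>
    rw [collapseHom_single, triangulate_mk, evalModel_single, cubeTriangulation, push_single,
      Finsupp.smul_single, smul_eq_mul, mul_one]
    congr 1
    ext1 s
    exact congrArg σ (Subsingleton.elim _ _)

/-! ### The natural chain homotopy -/

/-- Simplices are convex. No compatibility between different dimensions is needed: the contraction
serves only to fill cycles on the models. -/
theorem exists_simplexContraction (n : ℕ) : Nonempty (Σ b : Simplex n,
    (ContinuousMap.id (Simplex n)).Homotopy (ContinuousMap.const (Simplex n) b)) := by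
  have : ContractibleSpace (Simplex n) :=
    (convex_stdSimplex ℝ (Fin (n + 1))).contractibleSpace ⟨_, (stdSimplex.vertex 0).2⟩
  obtain ⟨b, ⟨H⟩⟩ := id_nullhomotopic (Simplex n)
  exact ⟨⟨b, H⟩⟩

/-- A contraction of the standard simplex. -/
def simplexContraction (n : ℕ) : Σ b : Simplex n,
    (ContinuousMap.id (Simplex n)).Homotopy (ContinuousMap.const (Simplex n) b) :=
  (exists_simplexContraction n).some

/-- The values on the models of the natural chain homotopy between the identity and
`triangulate ∘ collapseHom`. -/
def homotopyChain : ∀ n : ℕ, SingChain ℝ (n + 1) (Simplex n)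
  -- The composite is already the identity in degree `0`.
  | 0 => 0
  | n + 1 => cone (simplexContraction (n + 1)).2 (n + 1)
      (triangulate (n + 1) _ (collapseHom (n + 1) _ (Finsupp.single (ContinuousMap.id _) 1)) -
        Finsupp.single (ContinuousMap.id _) 1 -
        evalModel (homotopyChain n) (Simplex (n + 1))
          (singBoundary ℝ n _ (Finsupp.single (ContinuousMap.id _) 1)))

/-- As for cubes, naturality reduces the homotopy identity to the identity simplex. -/
theorem singBoundary_evalModel_homotopy {n : ℕ} {u : SingChain ℝ (n + 2) (Simplex (n + 1))}
    {v : SingChain ℝ (n + 1) (Simplex n)}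
    (h : singBoundary ℝ (n + 1) _ u =
      triangulate (n + 1) _ (collapseHom (n + 1) _ (Finsupp.single (ContinuousMap.id _) 1)) -
        Finsupp.single (ContinuousMap.id _) 1 -
        evalModel v (Simplex (n + 1))
          (singBoundary ℝ n _ (Finsupp.single (ContinuousMap.id _) 1)))
    {X : Type w} [TopologicalSpace X] (c : SingChain ℝ (n + 1) X) :
    singBoundary ℝ (n + 1) X (evalModel u X c) =
      triangulate (n + 1) X (collapseHom (n + 1) X c) - c -
        evalModel v X (singBoundary ℝ n X c) := by
  induction c using Finsupp.induction_linear with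
  | zero => simp
  | add f g hf hg => simp only [map_add, hf, hg]; abel
  | single σ a =>
    have hσ : Finsupp.single σ a =
        a • push σ (Finsupp.single (ContinuousMap.id (Simplex (n + 1))) (1 : ℝ)) := by
      rw [push_single, Finsupp.smul_single, smul_eq_mul, mul_one, ContinuousMap.comp_id]
    rw [evalModel_single, singBoundary_smul, singBoundary_push, h, map_sub, map_sub,
      push_evalModel, triangulate_collapseHom, push_evalModel, triangulate_collapseHom]
    change a • (evalModel _ X (push σ _) - push σ _ - evalModel v X (push σ _)) = _
    rw [hσ, singBoundary_smul, singBoundary_push, map_smul, map_smul, smul_sub, smul_sub]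

theorem singBoundary_homotopyChain (n : ℕ) :
    singBoundary ℝ (n + 1) _ (homotopyChain (n + 1)) =
      triangulate (n + 1) _ (collapseHom (n + 1) _ (Finsupp.single (ContinuousMap.id _) 1)) -
        Finsupp.single (ContinuousMap.id _) 1 -
        evalModel (homotopyChain n) (Simplex (n + 1))
          (singBoundary ℝ n _ (Finsupp.single (ContinuousMap.id _) 1)) := by
  rw [homotopyChain, singBoundary_cone, sub_eq_self]
  refine (congrArg _ ?_).trans (map_zero _)
  -- It remains to see that the coned chain is a cycle. Its degree is positive, so no coefficient
  -- sum intervenes. The homotopy identity one degree lower reduces the claim to `∂∂ = 0`.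
  rw [map_sub, map_sub, singBoundary_triangulate_collapseHom]
  cases n with
  | zero =>
    rw [triangulate_collapseHom_zero, homotopyChain, evalModel_zero, map_zero, sub_self,
      sub_zero]
  | succ n =>
    rw [singBoundary_evalModel_homotopy (singBoundary_homotopyChain n), singBoundary_singBoundary]
    simp

/-- The natural chain homotopy between the identity and `triangulate ∘ collapseHom`. -/
def chainHomotopy (n : ℕ) (X : Type v) [TopologicalSpace X] :
    SingChain ℝ n X →+ SingChain ℝ (n + 1) X :=
  (evalModel (homotopyChain n) X).toAddMonoidHom

theorem singMap_chainHomotopy {n : ℕ} {X Y : Type u} [TopologicalSpace X] [TopologicalSpace Y]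
    (f : C(X, Y)) (c : SingChain ℝ n X) :
    singMap ℝ (n + 1) f (chainHomotopy n X c) = chainHomotopy n Y (singMap ℝ n f c) :=
  push_evalModel _ f c

theorem singBoundary_chainHomotopy_zero {X : Type v} [TopologicalSpace X] (c : SingChain ℝ 0 X) :
    triangulate 0 X (collapseHom 0 X c) = singBoundary ℝ 0 X (chainHomotopy 0 X c) + c := by
  have : chainHomotopy 0 X c = 0 := by
    change evalModel (homotopyChain 0) X c = 0
    rw [homotopyChain, evalModel_zero]
  rw [this, triangulate_collapseHom_zero, map_zero, zero_add]

theorem singBoundary_chainHomotopy_succ {n : ℕ} {X : Type v} [TopologicalSpace X]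
    (c : SingChain ℝ (n + 1) X) :
    triangulate (n + 1) X (collapseHom (n + 1) X c) =
      chainHomotopy n X (singBoundary ℝ n X c) +
        singBoundary ℝ (n + 1) X (chainHomotopy (n + 1) X c) + c := by
  have h := singBoundary_evalModel_homotopy (singBoundary_homotopyChain n) c
  change singBoundary ℝ (n + 1) X (chainHomotopy (n + 1) X c) = _ -
    chainHomotopy n X (singBoundary ℝ n X c) at h
  rw [h]
  abel

/-! ### Norms of chains -/

/-- The `ℓ¹`-norm of a finite formal sum. -/
def l1Norm {α : Type*} (c : α →₀ ℝ) : ℝ≥0∞ := c.sum fun _ a => ‖a‖ₑ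

section L1

variable {α β : Type*}

theorem l1Norm_single (x : α) (a : ℝ) : l1Norm (Finsupp.single x a) = ‖a‖ₑ :=
  Finsupp.sum_single_index enorm_zero

theorem l1Norm_zero : l1Norm (0 : α →₀ ℝ) = 0 := Finsupp.sum_zero_index

theorem l1Norm_add_le (c d : α →₀ ℝ) : l1Norm (c + d) ≤ l1Norm c + l1Norm d := by
  classical
  have h : ∀ e : α →₀ ℝ, e.support ⊆ c.support ∪ d.support →
      l1Norm e = ∑ x ∈ c.support ∪ d.support, ‖e x‖ₑ := fun e he =>
    Finsupp.sum_of_support_subset _ he _ fun _ _ => enorm_zero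
  rw [h _ Finsupp.support_add, h c Finset.subset_union_left, h d Finset.subset_union_right,
    ← Finset.sum_add_distrib]
  exact Finset.sum_le_sum fun x _ => enorm_add_le _ _

theorem l1Norm_smul (a : ℝ) (c : α →₀ ℝ) : l1Norm (a • c) = ‖a‖ₑ * l1Norm c := by
  rw [l1Norm, Finsupp.sum_smul_index fun _ => enorm_zero, l1Norm, Finsupp.mul_sum]
  simp only [enorm_mul]

theorem l1Norm_neg (c : α →₀ ℝ) : l1Norm (-c) = l1Norm c := by
  rw [← neg_one_smul ℝ, l1Norm_smul]
  simp

theorem l1Norm_sum_le {ι : Type*} (s : Finset ι) (f : ι → α →₀ ℝ) :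
    l1Norm (∑ i ∈ s, f i) ≤ ∑ i ∈ s, l1Norm (f i) :=
  Finset.le_sum_of_subadditive _ l1Norm_zero.le l1Norm_add_le _ _

theorem l1Norm_linearCombination_le {K : ℝ≥0∞} (f : α → β →₀ ℝ) (hf : ∀ x, l1Norm (f x) ≤ K)
    (c : α →₀ ℝ) : l1Norm (Finsupp.linearCombination ℝ f c) ≤ K * l1Norm c := by
  rw [Finsupp.linearCombination_apply, l1Norm, l1Norm, Finsupp.mul_sum]
  refine (l1Norm_sum_le _ _).trans (Finset.sum_le_sum fun x _ => ?_)
  rw [l1Norm_smul, mul_comm]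
  exact mul_le_mul_left (hf x) _

theorem l1Norm_mapDomain_le (f : α → β) (c : α →₀ ℝ) :
    l1Norm (Finsupp.mapDomain f c) ≤ l1Norm c := by
  refine (l1Norm_sum_le _ _).trans (Finset.sum_le_sum fun x _ => ?_)
  rw [l1Norm_single]

end L1

/-- Each generator contributes a push-forward of `u`, and pushing forward does not increase the
`ℓ¹`-norm. -/
theorem l1Norm_evalModel_le {P : Type} [TopologicalSpace P] {m : ℕ} (u : SingChain ℝ m P)
    {X : Type v} [TopologicalSpace X] (q : C(P, X) →₀ ℝ) :
    l1Norm (evalModel u X q) ≤ l1Norm u * l1Norm q :=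
  l1Norm_linearCombination_le _ (fun _ => l1Norm_mapDomain_le _ _) q

theorem l1Norm_cubeBoundary_single_le {X : Type v} [TopologicalSpace X] {n : ℕ}
    (c : C(Cube (n + 1), X)) : l1Norm (cubeBoundary n X (Finsupp.single c 1)) ≤ 2 * (n + 1) := by
  rw [cubeBoundary_single]
  refine (l1Norm_sum_le _ _).trans ((Finset.sum_le_card_nsmul _ _ 2 fun j _ => ?_).trans ?_)
  · have h : l1Norm (Finsupp.single (c.comp (cubeFace j 1)) (1 : ℝ) -
        Finsupp.single (c.comp (cubeFace j 0)) 1) ≤ 2 := by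
      rw [sub_eq_add_neg]
      refine (l1Norm_add_le _ _).trans ?_
      rw [l1Norm_neg, l1Norm_single, l1Norm_single, enorm_one, one_add_one_eq_two]
    obtain hj | hj := neg_one_pow_eq_or ℤ (j : ℕ)
    · rwa [hj, one_smul]
    · rwa [hj, neg_one_smul, l1Norm_neg]
  · simp [mul_comm]

/-- Each recursion step multiplies the bound by the number `2 * (n + 1)` of faces; coning is induced
by a map of simplices and costs nothing. -/
theorem l1Norm_cubeTriangulation_le (n : ℕ) :
    l1Norm (cubeTriangulation n) ≤ 2 ^ n * (n.factorial : ℝ≥0∞) := by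
  induction n with
  | zero => simp [cubeTriangulation, l1Norm_single]
  | succ n ih =>
    rw [cubeTriangulation]
    refine (l1Norm_mapDomain_le _ _).trans ((l1Norm_evalModel_le _ _).trans
      ((mul_le_mul' ih (l1Norm_cubeBoundary_single_le _)).trans_eq ?_))
    rw [Nat.factorial_succ, pow_succ]
    push_cast
    ring

/-! ### Natural chain maps and chain homotopies -/

/-- The natural chain map from cubical to singular chains that triangulates each singular cube. -/
def cubicalToSing : cubical.{u} ⟶ singular.{u} ℝ where
  app X := ChainComplex.ofHom (X := cubicalComplex X) (Y := singComplex ℝ X)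
    (fun n => AddCommGrpCat.ofHom (triangulate n X))
    (fun n => by
      simp only [singComplex, cubicalComplex, ChainComplex.of_d]
      exact AddCommGrpCat.hom_ext (AddMonoidHom.ext fun c => singBoundary_triangulate c))
  naturality _ _ f := by
    ext n : 1
    refine AddCommGrpCat.hom_ext (AddMonoidHom.ext fun c => ?_)
    obtain ⟨q, rfl⟩ := QuotientAddGroup.mk_surjective c
    exact (push_evalModel (cubeTriangulation n) f.hom q).symm

theorem homologyMap_eq_id_of_homotopy {C : ChainComplex AddCommGrpCat.{u} ℕ} (f : C ⟶ C)
    (s : ∀ n, C.X n ⟶ C.X (n + 1)) (h0 : f.f 0 = s 0 ≫ C.d 1 0 + 𝟙 _)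
    (hs : ∀ n, f.f (n + 1) = C.d (n + 1) n ≫ s n + s (n + 1) ≫ C.d (n + 2) (n + 1) + 𝟙 _) (n : ℕ) :
    HomologicalComplex.homologyMap f n = 𝟙 _ := by
  let H : Homotopy f (𝟙 C) :=
    -- A `Homotopy` has components for all pairs of degrees; only those raising the degree by one
    -- are non-zero, up to transport along the equality of degrees.
    { hom := fun i j => if h : i + 1 = j then s i ≫ eqToHom (by rw [h]) else 0
      zero := fun i j h => dif_neg h
      comm := fun i => by
        cases i with
        | zero =>
          rw [Homotopy.dNext_zero_chainComplex, Homotopy.prevD_chainComplex, h0]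
          simp
        | succ n =>
          rw [Homotopy.dNext_succ_chainComplex, Homotopy.prevD_chainComplex, hs]
          simp }
  rw [H.homologyMap_eq, HomologicalComplex.homologyMap_id]

section Functorial

variable {F G : TopCat.{u} ⥤ ChainComplex AddCommGrpCat.{u} ℕ}

theorem relTrans_comp {E : TopCat.{u} ⥤ ChainComplex AddCommGrpCat.{u} ℕ} (φ : F ⟶ G) (ψ : G ⟶ E)
    {X : Type u} [TopologicalSpace X] (A : Set X) :
    relTrans (φ ≫ ψ) A = relTrans φ A ≫ relTrans ψ A := by
  ext n : 1
  refine AddCommGrpCat.hom_ext (AddMonoidHom.ext fun c => ?_)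
  obtain ⟨c, rfl⟩ := QuotientAddGroup.mk_surjective c
  rfl

theorem lfTrans_comp {E : TopCat.{u} ⥤ ChainComplex AddCommGrpCat.{u} ℕ} (φ : F ⟶ G) (ψ : G ⟶ E)
    (X : Type u) [TopologicalSpace X] : lfTrans (φ ≫ ψ) X = lfTrans φ X ≫ lfTrans ψ X := by
  ext n : 1
  refine AddCommGrpCat.hom_ext (AddMonoidHom.ext fun c => Subtype.ext (funext fun K => ?_))
  exact ConcreteCategory.congr_hom (congrArg (fun f => HomologicalComplex.Hom.f f n)
    (relTrans_comp φ ψ (K : Set X)ᶜ)) (lfComponent F c K)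

/-! ### Natural chain homotopies on relative and locally finite chains. -/

section Homotopy

/-- A natural chain homotopy between a natural chain map `g : F ⟶ F` and the identity. -/
structure HomotopyToId (g : F ⟶ F) where
  hom (X : TopCat.{u}) (n : ℕ) : (F.obj X).X n ⟶ (F.obj X).X (n + 1)
  naturality {X Y : TopCat.{u}} (f : X ⟶ Y) (n : ℕ) :
    hom X n ≫ (F.map f).f (n + 1) = (F.map f).f n ≫ hom Y n
  zero (X : TopCat.{u}) : (g.app X).f 0 = hom X 0 ≫ (F.obj X).d 1 0 + 𝟙 _
  succ (X : TopCat.{u}) (n : ℕ) : (g.app X).f (n + 1) = (F.obj X).d (n + 1) n ≫ hom X n +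
    hom X (n + 1) ≫ (F.obj X).d (n + 2) (n + 1) + 𝟙 _

variable {g : F ⟶ F} (h : HomotopyToId g)

/-- This is naturality with respect to the inclusion of `A`, and it makes the homotopy descend to
the quotient. -/
theorem relSubgroup_le_comap_homotopy {X : Type u} [TopologicalSpace X] (A : Set X) (n : ℕ) :
    relSubgroup F A n ≤ (relSubgroup F A (n + 1)).comap (h.hom (TopCat.of X) n).hom := by
  rintro _ ⟨a, rfl⟩
  exact ⟨(h.hom (TopCat.of A) n).hom a, ConcreteCategory.congr_hom (h.naturality (incl A) n) a⟩

/-- The maps on relative chains induced by a natural chain homotopy. -/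
def relHomotopy {X : Type u} [TopologicalSpace X] (A : Set X) (n : ℕ) :
    (relComplex F A).X n ⟶ (relComplex F A).X (n + 1) :=
  AddCommGrpCat.ofHom (QuotientAddGroup.map _ _ (h.hom (TopCat.of X) n).hom
    (relSubgroup_le_comap_homotopy h A n))

/-- The maps on locally finite chains induced by a natural chain homotopy. -/
def lfHomotopy (X : Type u) [TopologicalSpace X] (n : ℕ) :
    (lfComplex F X).X n ⟶ (lfComplex F X).X (n + 1) :=
  AddCommGrpCat.ofHom
    { toFun := fun c => ⟨fun K => (relHomotopy h (K : Set X)ᶜ n).hom (lfComponent F c K),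
        fun K L hKL => by
          refine Eq.trans ?_ (congrArg (relHomotopy h (K : Set X)ᶜ n).hom (c.2 K L hKL))
          obtain ⟨b, hb⟩ := QuotientAddGroup.mk_surjective (lfComponent F c L)
          change ((relMap F (Set.compl_subset_compl.2 hKL)).f (n + 1)).hom
              ((relHomotopy h (L : Set X)ᶜ n).hom (lfComponent F c L)) =
            (relHomotopy h (K : Set X)ᶜ n).hom
              (((relMap F (Set.compl_subset_compl.2 hKL)).f n).hom (lfComponent F c L))
          rw [← hb]
          rfl⟩
      map_zero' := Subtype.ext (funext fun K => map_zero _)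
      map_add' := fun a b => Subtype.ext (funext fun K => map_add _ _ _) }

theorem relTrans_f_zero {X : Type u} [TopologicalSpace X] (A : Set X) :
    (relTrans g A).f 0 = relHomotopy h A 0 ≫ (relComplex F A).d 1 0 + 𝟙 _ := by
  refine AddCommGrpCat.hom_ext (AddMonoidHom.ext fun c => ?_)
  obtain ⟨c, rfl⟩ := QuotientAddGroup.mk_surjective c
  exact congrArg QuotientAddGroup.mk (ConcreteCategory.congr_hom (h.zero (TopCat.of X)) c)

theorem relTrans_f_succ {X : Type u} [TopologicalSpace X] (A : Set X) (n : ℕ) :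
    (relTrans g A).f (n + 1) = (relComplex F A).d (n + 1) n ≫ relHomotopy h A n +
      relHomotopy h A (n + 1) ≫ (relComplex F A).d (n + 2) (n + 1) + 𝟙 _ := by
  refine AddCommGrpCat.hom_ext (AddMonoidHom.ext fun c => ?_)
  obtain ⟨c, rfl⟩ := QuotientAddGroup.mk_surjective c
  exact congrArg QuotientAddGroup.mk (ConcreteCategory.congr_hom (h.succ (TopCat.of X) n) c)

theorem homologyMap_relTrans_eq_id (h : HomotopyToId g) {X : Type u} [TopologicalSpace X] (A : Set X)
    (n : ℕ) : HomologicalComplex.homologyMap (relTrans g A) n = 𝟙 _ :=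
  homologyMap_eq_id_of_homotopy _ (relHomotopy h A) (relTrans_f_zero h A) (relTrans_f_succ h A) n

/-- The homotopy acts componentwise on compatible families, so its identities can be checked in each
relative complex. -/
theorem homologyMap_lfTrans_eq_id (h : HomotopyToId g) (X : Type u) [TopologicalSpace X] (n : ℕ) :
    HomologicalComplex.homologyMap (lfTrans g X) n = 𝟙 _ := by
  refine homologyMap_eq_id_of_homotopy _ (lfHomotopy h X) ?_ (fun n => ?_) n
  · refine AddCommGrpCat.hom_ext (AddMonoidHom.ext fun c => Subtype.ext (funext fun K => ?_))
    exact ConcreteCategory.congr_hom (relTrans_f_zero h (K : Set X)ᶜ) (lfComponent F c K)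
  · refine AddCommGrpCat.hom_ext (AddMonoidHom.ext fun c => Subtype.ext (funext fun K => ?_))
    exact ConcreteCategory.congr_hom (relTrans_f_succ h (K : Set X)ᶜ n) (lfComponent F c K)

end Homotopy

/-! ### Bounded chain maps and semi-norms -/

/-- The images of representing cycles represent the image class. Since `K` is neither zero nor
infinite, multiplication by it commutes with arbitrary infima in `ℝ≥0∞`, including empty ones. -/
theorem homologyNorm_map_le {C D : ChainComplex AddCommGrpCat.{u} ℕ} (f : C ⟶ D) {n : ℕ}
    {N : C.X n → ℝ≥0∞} {N' : D.X n → ℝ≥0∞} {K : ℝ≥0∞} (hK0 : K ≠ 0) (hK : K ≠ ⊤)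
    (hf : ∀ x, N' ((f.f n).hom x) ≤ K * N x) (α : C.homology n) :
    homologyNorm D n N' ((HomologicalComplex.homologyMap f n).hom α) ≤ K * homologyNorm C n N α := by
  simp only [homologyNorm, ENNReal.mul_iInf_of_ne hK0 hK]
  refine le_iInf₂ fun z hz => ?_
  refine (iInf₂_le ((HomologicalComplex.cyclesMap f n).hom z) ?_).trans ?_
  · rw [← hz]
    exact ConcreteCategory.congr_hom (HomologicalComplex.homologyπ_naturality f n).symm z
  · have : (D.iCycles n).hom ((HomologicalComplex.cyclesMap f n).hom z) =
        (f.f n).hom ((C.iCycles n).hom z) :=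
      ConcreteCategory.congr_hom (HomologicalComplex.cyclesMap_i f n) z
    rw [this]
    exact hf _

theorem relNorm_relTrans_le (ψ : F ⟶ G) {N : ∀ (X : TopCat.{u}) (n : ℕ), (F.obj X).X n → ℝ≥0∞}
    {N' : ∀ (X : TopCat.{u}) (n : ℕ), (G.obj X).X n → ℝ≥0∞} {n : ℕ} {K : ℝ≥0∞} (hK0 : K ≠ 0)
    (hK : K ≠ ⊤)
    (hψ : ∀ (X : TopCat.{u}) (c : (F.obj X).X n), N' X n (((ψ.app X).f n).hom c) ≤ K * N X n c)
    {X : Type u} [TopologicalSpace X] (A : Set X)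
    (c : (relComplex F A).X n) :
    relNorm N' A n (((relTrans ψ A).f n).hom c) ≤ K * relNorm N A n c := by
  simp only [relNorm, ENNReal.mul_iInf_of_ne hK0 hK]
  refine le_iInf₂ fun b hb => ?_
  refine (iInf₂_le (((ψ.app (TopCat.of X)).f n).hom b) ?_).trans (hψ _ b)
  rw [← hb]
  rfl

/-- The hypothesis gives `limsup f ≤ liminf f + ε` for every `ε`. It serves to produce the limit of
norms that `lfNorm` requires of a Cauchy family. -/
theorem exists_tendsto_of_forall_le_add {ι : Type*} [SemilatticeSup ι] [Nonempty ι]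
    (f : ι → ℝ≥0∞)
    (hf : ∀ ε : ℝ≥0∞, 0 < ε → ∃ i₀, ∀ i j, i₀ ≤ i → i₀ ≤ j → f i ≤ f j + ε) :
    ∃ l, Tendsto f atTop (𝓝 l) := by
  refine ⟨_, tendsto_of_le_liminf_of_limsup_le le_rfl (?_ : limsup f atTop ≤ liminf f atTop)⟩
  refine ENNReal.le_of_forall_pos_le_add fun ε hε _ => ?_
  obtain ⟨i₀, h⟩ := hf ε (by exact_mod_cast hε)
  rw [← tsub_le_iff_right]
  refine le_liminf_of_le (by isBoundedDefault) ?_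
  filter_upwards [eventually_ge_atTop i₀] with j hj
  rw [tsub_le_iff_right]
  refine limsup_le_of_le (by isBoundedDefault) ?_
  filter_upwards [eventually_ge_atTop i₀] with i hi
  exact h i j hi hj

/-- The image of an admissible family is admissible: it is Cauchy because `ψ` is bounded, and its
norms converge by `hN'`. The bound then passes to the limit. -/
theorem lfNorm_lfTrans_le (ψ : F ⟶ G) {N : ∀ (X : TopCat.{u}) (n : ℕ), (F.obj X).X n → ℝ≥0∞}
    {N' : ∀ (X : TopCat.{u}) (n : ℕ), (G.obj X).X n → ℝ≥0∞} {n : ℕ} {K : ℝ≥0∞} (hK0 : K ≠ 0)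
    (hK : K ≠ ⊤)
    (hψ : ∀ (X : TopCat.{u}) (c : (F.obj X).X n), N' X n (((ψ.app X).f n).hom c) ≤ K * N X n c)
    (hN' : ∀ (X : TopCat.{u}) (x y : (G.obj X).X n), N' X n x ≤ N' X n y + N' X n (x - y))
    (X : Type u) [TopologicalSpace X] (c : (lfComplex F X).X n) :
    lfNorm N' X n (((lfTrans ψ X).f n).hom c) ≤ K * lfNorm N X n c := by
  simp only [lfNorm, ENNReal.mul_iInf_of_ne hK0 hK]
  refine le_iInf₂ fun b hb => le_iInf₂ fun hC l => le_iInf fun hl => ?_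
  have hC' : ∀ ε : ℝ≥0∞, 0 < ε → ∃ K₀, ∀ K L, K₀ ≤ K → K₀ ≤ L →
      N' (TopCat.of X) n (((ψ.app (TopCat.of X)).f n).hom (b K) -
        ((ψ.app (TopCat.of X)).f n).hom (b L)) < ε := by
    intro ε hε
    -- The tolerance is divided by `K` to absorb the bound on `ψ`; it stays positive as `K` is
    -- finite.
    obtain ⟨K₀, h⟩ := hC (ε / K) (ENNReal.div_pos hε.ne' hK)
    refine ⟨K₀, fun L L' hL hL' => ?_⟩
    rw [← map_sub]
    exact (hψ _ _).trans_lt (ENNReal.mul_lt_of_lt_div' (h L L' hL hL'))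
  obtain ⟨l', hl'⟩ := exists_tendsto_of_forall_le_add
    (fun L => N' (TopCat.of X) n (((ψ.app (TopCat.of X)).f n).hom (b L))) (fun ε hε => by
      obtain ⟨K₀, h⟩ := hC' ε hε
      exact ⟨K₀, fun L L' hL hL' => (hN' _ _ _).trans (add_le_add_right (h L L' hL hL').le _)⟩)
  refine (iInf₂_le (fun L => ((ψ.app (TopCat.of X)).f n).hom (b L)) fun L => ?_).trans
    ((iInf₂_le hC' l').trans ((iInf_le _ hl').trans ?_))
  · change _ = ((relTrans ψ (L : Set X)ᶜ).f n).hom (lfComponent F c L)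
    rw [← hb L]
    rfl
  · exact le_of_tendsto_of_tendsto' hl' (ENNReal.Tendsto.const_mul hl (Or.inr hK)) fun L => hψ _ _

end Functorial

/-! ### Comparison of the norms -/

theorem singNorm_le_add_sub (X : TopCat.{u}) (n : ℕ) (x y : ((singular ℝ).obj X).X n) :
    singNorm X n x ≤ singNorm X n y + singNorm X n (x - y) := by
  have h := l1Norm_add_le (show SingChain ℝ n X from y) (show SingChain ℝ n X from x - y)
  have e : (show SingChain ℝ n X from y) + (show SingChain ℝ n X from x - y) = x :=
    add_sub_cancel _ _
  rw [e] at h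
  exact h

/-- The sum of a lift of `y` and a lift of `x - y` is a lift of `x`. -/
theorem cubicalNorm_le_add_sub (X : TopCat.{u}) (n : ℕ) (x y : (cubical.obj X).X n) :
    cubicalNorm X n x ≤ cubicalNorm X n y + cubicalNorm X n (x - y) := by
  simp only [cubicalNorm, ENNReal.iInf_add, ENNReal.add_iInf]
  refine le_iInf₂ fun q hq => le_iInf₂ fun r hr => ?_
  refine (iInf₂_le (r + q) ?_).trans (l1Norm_add_le r q)
  rw [QuotientAddGroup.mk_add, hq, hr]
  exact add_sub_cancel y x

theorem cubicalNorm_mk_le (X : TopCat.{u}) {n : ℕ} (q : CubeChain n X) :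
    cubicalNorm X n (QuotientAddGroup.mk q : CubicalChain n X) ≤ l1Norm q :=
  iInf₂_le (f := fun (q' : CubeChain n X) _ => l1Norm q') q rfl

theorem cubicalNorm_singToCubical_le (X : TopCat.{u}) (n : ℕ) (c : ((singular ℝ).obj X).X n) :
    cubicalNorm X n (((singToCubical.app X).f n).hom c) ≤ 1 * singNorm X n c := by
  rw [one_mul]
  exact (cubicalNorm_mk_le X (Finsupp.mapDomain (fun σ : C(Simplex n, X) => σ.comp (collapse n))
    (show SingChain ℝ n X from c))).trans (l1Norm_mapDomain_le _ _)

theorem two_pow_mul_factorial_ne_zero (n : ℕ) : (2 ^ n * (n.factorial : ℝ≥0∞)) ≠ 0 :=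
  mul_ne_zero (pow_ne_zero _ two_ne_zero) (Nat.cast_ne_zero.2 n.factorial_ne_zero)

theorem two_pow_mul_factorial_ne_top (n : ℕ) : (2 ^ n * (n.factorial : ℝ≥0∞)) ≠ ⊤ :=
  ENNReal.mul_ne_top (ENNReal.pow_ne_top ENNReal.ofNat_ne_top) (ENNReal.natCast_ne_top _)

/-- The estimate holds for every representative in `Q_n`, since the triangulation ignores degenerate
cubes; hence it holds for the quotient norm. -/
theorem singNorm_cubicalToSing_le (X : TopCat.{u}) (n : ℕ) (c : (cubical.obj X).X n) :
    singNorm X n (((cubicalToSing.app X).f n).hom c) ≤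
      2 ^ n * (n.factorial : ℝ≥0∞) * cubicalNorm X n c := by
  simp only [cubicalNorm, ENNReal.mul_iInf_of_ne (two_pow_mul_factorial_ne_zero n)
    (two_pow_mul_factorial_ne_top n)]
  refine le_iInf₂ fun q hq => ?_
  rw [← hq]
  exact (l1Norm_evalModel_le (cubeTriangulation n) q).trans
    (mul_le_mul_left (l1Norm_cubeTriangulation_le n) _)

/-! ### The left inverse in homology and the comparison of semi-norms. -/

theorem singular_d (X : TopCat.{u}) (n : ℕ) :
    ((singular ℝ).obj X).d (n + 1) n = AddCommGrpCat.ofHom (singBoundary ℝ n X) := by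
  change (singComplex ℝ X).d (n + 1) n = _
  simp only [singComplex, ChainComplex.of_d]

/-- The natural chain homotopy between the identity of the singular chain complex and the
composition with the maps to and from the cubical chain complex. -/
def homotopySingToCubical : HomotopyToId (singToCubical.{u} ≫ cubicalToSing) where
  hom X n := AddCommGrpCat.ofHom (chainHomotopy n X)
  naturality f n := AddCommGrpCat.hom_ext (AddMonoidHom.ext fun c =>
    singMap_chainHomotopy f.hom c)
  zero X := by
    rw [singular_d]
    exact AddCommGrpCat.hom_ext (AddMonoidHom.ext fun c => singBoundary_chainHomotopy_zero c)
  succ X n := by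
    rw [singular_d, singular_d]
    exact AddCommGrpCat.hom_ext (AddMonoidHom.ext fun c => singBoundary_chainHomotopy_succ c)

theorem homologyMap_relTrans_cubicalToSing {X : Type u} [TopologicalSpace X] (A : Set X) (n : ℕ)
    (α : relHomology ℝ A n) :
    (HomologicalComplex.homologyMap (relTrans cubicalToSing A) n).hom
      ((HomologicalComplex.homologyMap (relTrans singToCubical A) n).hom α) = α := by
  have h := homologyMap_relTrans_eq_id homotopySingToCubical A n
  rw [relTrans_comp, HomologicalComplex.homologyMap_comp] at h
  exact ConcreteCategory.congr_hom h α

theorem homologyMap_lfTrans_cubicalToSing (X : Type u) [TopologicalSpace X] (n : ℕ)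
    (α : (lfComplex (singular.{u} ℝ) X).homology n) :
    (HomologicalComplex.homologyMap (lfTrans cubicalToSing X) n).hom
      ((HomologicalComplex.homologyMap (lfTrans singToCubical X) n).hom α) = α := by
  have h := homologyMap_lfTrans_eq_id homotopySingToCubical X n
  rw [lfTrans_comp, HomologicalComplex.homologyMap_comp] at h
  exact ConcreteCategory.congr_hom h α

theorem homologyNorm_rel_cubical_le {X : Type u} [TopologicalSpace X] (A : Set X) (n : ℕ)
    (α : relHomology ℝ A n) :
    homologyNorm _ n (relNorm cubicalNorm A n)
      ((HomologicalComplex.homologyMap (relTrans singToCubical A) n).hom α) ≤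
        homologyNorm _ n (relNorm singNorm A n) α :=
  (homologyNorm_map_le _ one_ne_zero ENNReal.one_ne_top
    (relNorm_relTrans_le singToCubical one_ne_zero ENNReal.one_ne_top
      (cubicalNorm_singToCubical_le · n) A) α).trans_eq (one_mul _)

/-- The class `α` is recovered by triangulating its cubical counterpart, so the norm bound of
`cubicalToSing` applies to it. -/
theorem homologyNorm_rel_sing_le {X : Type u} [TopologicalSpace X] (A : Set X) (n : ℕ)
    (α : relHomology ℝ A n) :
    homologyNorm _ n (relNorm singNorm A n) α ≤ 2 ^ n * (n.factorial : ℝ≥0∞) *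
      homologyNorm _ n (relNorm cubicalNorm A n)
        ((HomologicalComplex.homologyMap (relTrans singToCubical A) n).hom α) := by
  conv_lhs => rw [← homologyMap_relTrans_cubicalToSing A n α]
  exact homologyNorm_map_le _ (two_pow_mul_factorial_ne_zero n) (two_pow_mul_factorial_ne_top n)
    (relNorm_relTrans_le cubicalToSing (two_pow_mul_factorial_ne_zero n)
      (two_pow_mul_factorial_ne_top n) (singNorm_cubicalToSing_le · n) A) _

theorem homologyNorm_lf_cubical_le (X : Type u) [TopologicalSpace X] (n : ℕ)
    (α : (lfComplex (singular.{u} ℝ) X).homology n) :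
    homologyNorm _ n (lfNorm cubicalNorm X n)
      ((HomologicalComplex.homologyMap (lfTrans singToCubical X) n).hom α) ≤
        homologyNorm _ n (lfNorm singNorm X n) α :=
  (homologyNorm_map_le _ one_ne_zero ENNReal.one_ne_top
    (lfNorm_lfTrans_le singToCubical one_ne_zero ENNReal.one_ne_top
      (cubicalNorm_singToCubical_le · n) (cubicalNorm_le_add_sub · n) X) α).trans_eq (one_mul _)

theorem homologyNorm_lf_sing_le (X : Type u) [TopologicalSpace X] (n : ℕ)
    (α : (lfComplex (singular.{u} ℝ) X).homology n) :
    homologyNorm _ n (lfNorm singNorm X n) α ≤ 2 ^ n * (n.factorial : ℝ≥0∞) *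
      homologyNorm _ n (lfNorm cubicalNorm X n)
        ((HomologicalComplex.homologyMap (lfTrans singToCubical X) n).hom α) := by
  conv_lhs => rw [← homologyMap_lfTrans_cubicalToSing X n α]
  exact homologyNorm_map_le _ (two_pow_mul_factorial_ne_zero n) (two_pow_mul_factorial_ne_top n)
    (lfNorm_lfTrans_le cubicalToSing (two_pow_mul_factorial_ne_zero n)
      (two_pow_mul_factorial_ne_top n) (singNorm_cubicalToSing_le · n) (singNorm_le_add_sub · n) X) _

/-- Both volumes are infima over the same fundamental classes, so a bound for each class suffices.
-/
theorem one_div_mul_iInf_le {ι : Type*} {p : ι → Prop} {a b : ι → ℝ≥0∞} {K : ℝ≥0∞} (hK0 : K ≠ 0)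
    (hK : K ≠ ⊤) (h : ∀ i, a i ≤ K * b i) :
    1 / K * ⨅ (i) (_ : p i), a i ≤ ⨅ (i) (_ : p i), b i := by
  refine le_iInf₂ fun i hi => ?_
  rw [one_div, ENNReal.inv_mul_le_iff hK0 hK]
  exact (iInf₂_le i hi).trans (h i)

end CubicalVolume

end

theorem corollary4p4 (n : ℕ) :
    (∀ (M : Type u) [TopologicalSpace M] [CompactSpace M],
      CubicalVolume.IsManifoldWithBoundary n M →
      ∀ o : CubicalVolume.ManifoldOrientation n M,
        1 / (2 ^ n * (n.factorial : ℝ≥0∞)) * CubicalVolume.simplicialVolume o ≤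
            CubicalVolume.cubicalSimplicialVolume o ∧
          CubicalVolume.cubicalSimplicialVolume o ≤ CubicalVolume.simplicialVolume o) ∧
    (∀ (M : Type u) [TopologicalSpace M],
      CubicalVolume.IsManifoldWithBoundary n M → CubicalVolume.manifoldBoundary n M = ∅ →
      ∀ o : CubicalVolume.ManifoldOrientation n M,
        1 / (2 ^ n * (n.factorial : ℝ≥0∞)) * CubicalVolume.lfSimplicialVolume o ≤
            CubicalVolume.lfCubicalSimplicialVolume o ∧
          CubicalVolume.lfCubicalSimplicialVolume o ≤ CubicalVolume.lfSimplicialVolume o) := by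
  have h0 := CubicalVolume.two_pow_mul_factorial_ne_zero n
  have h1 := CubicalVolume.two_pow_mul_factorial_ne_top n
  refine ⟨fun M _ _ _ o => ⟨?_, ?_⟩, fun M _ _ _ o => ⟨?_, ?_⟩⟩
  · exact CubicalVolume.one_div_mul_iInf_le h0 h1 (CubicalVolume.homologyNorm_rel_sing_le _ n)
  · exact iInf₂_mono fun α _ => CubicalVolume.homologyNorm_rel_cubical_le _ n α
  · exact CubicalVolume.one_div_mul_iInf_le h0 h1 (CubicalVolume.homologyNorm_lf_sing_le M n)
  · exact iInf₂_mono fun α _ => CubicalVolume.homologyNorm_lf_cubical_le M n α
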